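/- Let $\gamma\in(0,1)$ and $0<\varepsilon\leqslant 1$ be fixed real numbers, and for $N\in\mathbb N$ large enough that $\log\log N>0$ put \[ d_N=(1-\gamma)\sqrt{\frac{\log N}{2\log\log N}} . \] For a finite group $G$ and $p\in[0,1]$ let $\mathcal G(G,p)$ be the probability space of Cayley graphs $\Gamma(G;S)$, where the random set $S\subseteq G$ contains each element of $G$ independently with probability $p$; the vertex set of $\Gamma(G;S)$ is $G$, and distinct $g,h\in G$ are adjacent if and only if $g^{-1}h\in S$ or $h^{-1}g\in S$. The diameter of a disconnected graph is $\infty$. Let $d,N\in\mathbb N$ with $2\leqslant d\leqslant d_N$, and let $G$ be any abelian group of order $N$. If $\Gamma\in\mathcal G(G,p)$, where \[ p\leqslant\sqrt[d]{\frac{d!\,(1-\varepsilon)}{2^d}\cdot\frac{\log N}{N^{d-1}}}, \] then with high probability the diameter of $\Gamma$ is greater than $d$. Here "with high probability" means that the error probability tends to $0$ as $N\to\infty$, uniformly over all such $G$, $d$ and $p$: for every $\eta>0$ there is $N_0=N_0(\gamma,\varepsilon,\eta)$ such that for all $N\geqslant N_0$, all abelian groups $G$ of order $N$, all integers $d$ with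 $2\leqslant d\leqslant d_N$ and all $p\in[0,1]$ satisfying the bound above, $\Pr(\operatorname{diam}\Gamma>d)\geqslant 1-\eta$. -/

import Mathlib

open MeasureTheory ProbabilityTheory

/-- The random Cayley graph model: the law of the undirected Cayley graph `Γ(G; S)`, where the random
set `S ⊆ G` contains every element of `G` independently with probability `p`. In `mulCayley S`
two vertices `g ≠ h` are adjacent if and only if `g⁻¹ * h ∈ S` or `h⁻¹ * g ∈ S`. -/
noncomputable def randomCayley (G : Type*) [Group G] (p : unitInterval) :
    Measure (SimpleGraph G) :=
  (setBernoulli (Set.univ : Set G) p).map (fun S : Set G => SimpleGraph.mulCayley S)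

/-- For a finite group the random set takes its values in a finite discrete space, so every map out
of it is measurable. -/
theorem measurable_mulCayley_of_finite (G : Type*) [Group G] [Finite G] :
    Measurable (fun S : Set G => SimpleGraph.mulCayley S) :=
  Measurable.of_discrete

instance instIsProbabilityMeasureRandomCayley (G : Type*) [Group G] [Finite G]
    (p : unitInterval) : IsProbabilityMeasure (randomCayley G p) :=
  Measure.isProbabilityMeasure_map (measurable_mulCayley_of_finite G).aemeasurable

/-- The range of diameters: `d_N = (1 - γ) √(log N / (2 log log N))`. -/
noncomputable def diamBound (γ : ℝ) (N : ℕ) : ℝ :=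
  (1 - γ) * √(Real.log N / (2 * Real.log (Real.log N)))

/-- The threshold probability for abelian groups: the `d`-th root of
`(d! (1 - ε) / 2 ^ d) * (log N / N ^ (d - 1))`. -/
noncomputable def abelianThreshold (ε : ℝ) (d N : ℕ) : ℝ :=
  (((d.factorial : ℝ) * (1 - ε) / 2 ^ d) * (Real.log N / (N : ℝ) ^ (d - 1))) ^ (1 / (d : ℝ))

/-- On a finite vertex set every set of graphs is an event. -/
theorem measurableSet_simpleGraph_of_finite {V : Type*} [Finite V] (s : Set (SimpleGraph V)) :
    MeasurableSet s :=
  SimpleGraph.measurableEmbedding_edgeSet.measurableSet_image.1 MeasurableSet.of_discrete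

/-- The probability of a graph property is the probability that the random set generates a Cayley
graph with that property. -/
theorem randomCayley_real_apply (G : Type*) [Group G] [Finite G] (p : unitInterval)
    (s : Set (SimpleGraph G)) :
    (randomCayley G p).real s =
      (setBernoulli (Set.univ : Set G) p).real {S | SimpleGraph.mulCayley S ∈ s} := by
  rw [randomCayley, measureReal_def, Measure.map_apply (measurable_mulCayley_of_finite G)
    (measurableSet_simpleGraph_of_finite s)]
  rfl

/-! Call `g` missed if no `d`-element subset of `S` has a product, some factors being inverted,
equal to `g`, and degenerate if it is a product of bounded powers of fewer than `d` elements of `S`.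
In an abelian group a walk of length at most `d` from `1` to `g` collapses to exponents of total
size at most `d`. Hence a missed, nondegenerate `g` is at distance more than `d` from `1`
(`lt_ediam_mulCayley`), and the second moment method produces one.

First moment: by commutativity, sets rather than sequences represent `g`, at most `2^d N^(d-1) / d!`
of them (`factorial_mul_card_signedFamily_le`). So on average at most `(1 - ε) log N` lie in `S`,
and Harris' inequality makes `g` missed with probability at least `N^(-(1 - ε/2))`
(`exp_neg_le_bernoulliExp_avoidInd`). The mean number of missed elements is thus at least `N^(ε/2)`.

Variance: in the Efron–Stein inequality, toggling `x` matters only if `x` completes a representing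
set. That event is increasing while being missed is decreasing, so Harris' inequality separates them
(`bernoulliExp_influence_le`). For the number `X` of missed elements this gives `Var X ≤ c E X + δ E
X²`: `c` comes from sets representing two elements at once, `δ` from distinct overlapping sets. A
small `δ` is absorbed, so pair probabilities are never estimated.

Degeneracy: few elements are likely to be degenerate, so `X` counts only a set `T` of at least half
of the group where this is unlikely. Being missed and being degenerate are negatively correlated,
again by Harris' inequality, so few missed elements of `T` are degenerate on average.

The range of `d` enters because `N^(1/d)` must beat `d^(2d) (log N)²` and smaller factors
(`eventually_growth`). -/

/-! ### Product measure on finite subsets: Harris and Efron–Stein inequalities. -/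

section BernoulliExp

variable {ι : Type*} [DecidableEq ι]

/-- The expectation of `f` on a random subset of `V` that contains each element of `V`
independently with probability `p`. -/
noncomputable def bernoulliExp (p : ℝ) (V : Finset ι) (f : Finset ι → ℝ) : ℝ :=
  ∑ S ∈ V.powerset, p ^ S.card * (1 - p) ^ (V \ S).card * f S

theorem bernoulliExp_empty (p : ℝ) (f : Finset ι → ℝ) : bernoulliExp p ∅ f = f ∅ := by
  simp [bernoulliExp]

theorem bernoulliExp_congr (p : ℝ) {V : Finset ι} {f g : Finset ι → ℝ}
    (h : ∀ S ⊆ V, f S = g S) : bernoulliExp p V f = bernoulliExp p V g := by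
  unfold bernoulliExp
  refine Finset.sum_congr rfl fun S hS => ?_
  rw [h S (Finset.mem_powerset.1 hS)]

/-- Conditioning on the single coordinate `x`; the correlation and variance inequalities below are
inductions on this identity. -/
theorem bernoulliExp_insert (p : ℝ) {V : Finset ι} {x : ι} (hx : x ∉ V) (f : Finset ι → ℝ) :
    bernoulliExp p (insert x V) f =
      (1 - p) * bernoulliExp p V f + p * bernoulliExp p V (fun S => f (insert x S)) := by
  unfold bernoulliExp
  rw [Finset.sum_powerset_insert hx, Finset.mul_sum, Finset.mul_sum]
  congr 1 <;> refine Finset.sum_congr rfl fun S hS => ?_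
  · have hS' := Finset.mem_powerset.1 hS
    have : insert x V \ S = insert x (V \ S) :=
      Finset.insert_sdiff_of_notMem _ (fun h => hx (hS' h))
    rw [this, Finset.card_insert_of_notMem (by simp [hx])]
    ring
  · have hS' := Finset.mem_powerset.1 hS
    have hxS : x ∉ S := fun h => hx (hS' h)
    have : insert x V \ insert x S = V \ S := by
      ext y; simp only [Finset.mem_sdiff, Finset.mem_insert]
      constructor
      · rintro ⟨h1 | h1, h2⟩ <;> simp_all
      · rintro ⟨h1, h2⟩
        refine ⟨Or.inr h1, ?_⟩
        rintro (rfl | h)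
        · exact hx h1
        · exact h2 h
    rw [this, Finset.card_insert_of_notMem hxS]
    ring

theorem bernoulliExp_add (p : ℝ) (V : Finset ι) (f g : Finset ι → ℝ) :
    bernoulliExp p V (fun S => f S + g S) = bernoulliExp p V f + bernoulliExp p V g := by
  simp [bernoulliExp, mul_add, Finset.sum_add_distrib]

theorem bernoulliExp_sub (p : ℝ) (V : Finset ι) (f g : Finset ι → ℝ) :
    bernoulliExp p V (fun S => f S - g S) = bernoulliExp p V f - bernoulliExp p V g := by
  simp [bernoulliExp, mul_sub, Finset.sum_sub_distrib]

theorem bernoulliExp_const_mul (p : ℝ) (V : Finset ι) (c : ℝ) (f : Finset ι → ℝ) :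
    bernoulliExp p V (fun S => c * f S) = c * bernoulliExp p V f := by
  simp only [bernoulliExp, Finset.mul_sum]
  exact Finset.sum_congr rfl fun S _ => by ring

theorem bernoulliExp_sum {γ : Type*} (p : ℝ) (V : Finset ι) (T : Finset γ)
    (f : γ → Finset ι → ℝ) :
    bernoulliExp p V (fun S => ∑ g ∈ T, f g S) = ∑ g ∈ T, bernoulliExp p V (f g) := by
  simp only [bernoulliExp, Finset.mul_sum]
  exact Finset.sum_comm

theorem bernoulliExp_const (p : ℝ) (V : Finset ι) (c : ℝ) :
    bernoulliExp p V (fun _ => c) = c := by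
  induction V using Finset.induction_on with
  | empty => simp [bernoulliExp_empty]
  | insert x V hx ih => rw [bernoulliExp_insert p hx, ih]; ring

variable {p : ℝ}

theorem bernoulliExp_mono (hp0 : 0 ≤ p) (hp1 : p ≤ 1) {V : Finset ι} {f g : Finset ι → ℝ}
    (h : ∀ S ⊆ V, f S ≤ g S) : bernoulliExp p V f ≤ bernoulliExp p V g := by
  have : 0 ≤ 1 - p := by linarith
  unfold bernoulliExp
  refine Finset.sum_le_sum fun S hS => ?_
  exact mul_le_mul_of_nonneg_left (h S (Finset.mem_powerset.1 hS)) (by positivity)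

theorem bernoulliExp_nonneg (hp0 : 0 ≤ p) (hp1 : p ≤ 1) {V : Finset ι} {f : Finset ι → ℝ}
    (h : ∀ S ⊆ V, 0 ≤ f S) : 0 ≤ bernoulliExp p V f := by
  simpa [bernoulliExp_const] using bernoulliExp_mono hp0 hp1 (f := fun _ => (0 : ℝ)) h

theorem bernoulliExp_erase {V : Finset ι} {x : ι} (hx : x ∈ V) (f : Finset ι → ℝ) :
    bernoulliExp p V (fun S => f (S.erase x)) = bernoulliExp p (V.erase x) f := by
  conv_lhs => rw [← Finset.insert_erase hx]
  rw [bernoulliExp_insert p (Finset.notMem_erase x V)]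
  have h1 : bernoulliExp p (V.erase x) (fun S => f (S.erase x)) = bernoulliExp p (V.erase x) f :=
    bernoulliExp_congr p fun S hS => by
      rw [Finset.erase_eq_of_notMem fun h => Finset.notMem_erase x V (hS h)]
  have h2 : bernoulliExp p (V.erase x) (fun S => f ((insert x S).erase x)) =
      bernoulliExp p (V.erase x) f :=
    bernoulliExp_congr p fun S hS => by
      rw [Finset.erase_insert fun h => Finset.notMem_erase x V (hS h)]
  rw [h1, h2]; ring

theorem bernoulliExp_eq_erase_add_insert {V : Finset ι} {x : ι} (hx : x ∈ V)
    (f : Finset ι → ℝ) :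
    bernoulliExp p V f = (1 - p) * bernoulliExp p V (fun S => f (S.erase x)) +
      p * bernoulliExp p (V.erase x) (fun S => f (insert x S)) := by
  rw [bernoulliExp_erase hx]
  conv_lhs => rw [← Finset.insert_erase hx]
  rw [bernoulliExp_insert p (Finset.notMem_erase x V)]

/-- The probability that a given set is contained in the random set. -/
theorem bernoulliExp_superset {V A : Finset ι} (hA : A ⊆ V) :
    bernoulliExp p V (fun S => if A ⊆ S then 1 else 0) = p ^ A.card := by
  induction V using Finset.induction_on generalizing A with
  | empty => simp [bernoulliExp_empty, Finset.subset_empty.1 hA]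
  | insert x V hx ih =>
    rw [bernoulliExp_insert p hx]
    by_cases hxA : x ∈ A
    · have h0 : bernoulliExp p V (fun S => if A ⊆ S then (1 : ℝ) else 0) = 0 := by
        rw [bernoulliExp_congr p (g := fun _ => 0), bernoulliExp_const]
        intro S hS
        rw [if_neg fun h => hx (hS (h hxA))]
      simp only [h0, Finset.subset_insert_iff]
      rw [ih (Finset.subset_insert_iff.1 hA)]
      rw [← Finset.card_erase_add_one hxA, pow_succ]; ring
    · have hA' : A ⊆ V := (Finset.subset_insert_iff_of_notMem hxA).1 hA
      simp only [Finset.subset_insert_iff_of_notMem hxA]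
      rw [ih hA']; ring

theorem sq_bernoulliExp_le (hp0 : 0 ≤ p) (hp1 : p ≤ 1) (V : Finset ι) (f : Finset ι → ℝ) :
    bernoulliExp p V f ^ 2 ≤ bernoulliExp p V (fun S => f S ^ 2) := by
  have h := bernoulliExp_nonneg hp0 hp1 (V := V)
    (f := fun S => f S ^ 2 + (-2 * bernoulliExp p V f * f S + bernoulliExp p V f ^ 2))
    (fun S _ => by nlinarith [sq_nonneg (f S - bernoulliExp p V f)])
  rw [bernoulliExp_add, bernoulliExp_add, bernoulliExp_const_mul, bernoulliExp_const] at h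
  nlinarith

/-- Harris' inequality for increasing functions. -/
theorem bernoulliExp_mul_le_of_monotone (hp0 : 0 ≤ p) (hp1 : p ≤ 1) (V : Finset ι)
    {f g : Finset ι → ℝ} (hf : Monotone f) (hg : Monotone g) :
    bernoulliExp p V f * bernoulliExp p V g ≤ bernoulliExp p V (fun S => f S * g S) := by
  induction V using Finset.induction_on generalizing f g with
  | empty => simp [bernoulliExp_empty]
  | insert x V hx ih =>
    simp only [bernoulliExp_insert p hx]
    have hi : Monotone fun S : Finset ι => insert x S :=
      fun _ _ h => Finset.insert_subset_insert x h
    have h0 := ih hf hg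
    have h1 := ih (hf.comp hi) (hg.comp hi)
    simp only [Function.comp_def] at h1
    have hf' : bernoulliExp p V f ≤ bernoulliExp p V (fun S => f (insert x S)) :=
      bernoulliExp_mono hp0 hp1 fun S _ => hf (Finset.subset_insert x S)
    have hg' : bernoulliExp p V g ≤ bernoulliExp p V (fun S => g (insert x S)) :=
      bernoulliExp_mono hp0 hp1 fun S _ => hg (Finset.subset_insert x S)
    have hq : 0 ≤ 1 - p := by linarith
    have e1 := mul_le_mul_of_nonneg_left h0 hq
    have e2 := mul_le_mul_of_nonneg_left h1 hp0
    -- The covariance of the two conditional means over the coordinate `x` is exactly this product.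
    have e3 := mul_nonneg (mul_nonneg hp0 hq) (mul_nonneg (sub_nonneg.2 hf') (sub_nonneg.2 hg'))
    nlinarith

theorem bernoulliExp_neg (p : ℝ) (V : Finset ι) (f : Finset ι → ℝ) :
    bernoulliExp p V (fun S => -f S) = -bernoulliExp p V f := by
  simp [bernoulliExp]

/-- Harris' inequality for decreasing functions. -/
theorem bernoulliExp_mul_le_of_antitone (hp0 : 0 ≤ p) (hp1 : p ≤ 1) (V : Finset ι)
    {f g : Finset ι → ℝ} (hf : Antitone f) (hg : Antitone g) :
    bernoulliExp p V f * bernoulliExp p V g ≤ bernoulliExp p V (fun S => f S * g S) := by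
  have h := bernoulliExp_mul_le_of_monotone hp0 hp1 V hf.neg hg.neg
  simp only [bernoulliExp_neg] at h
  simpa using h

/-- Harris' inequality for a decreasing and an increasing function. -/
theorem bernoulliExp_mul_le_of_antitone_monotone (hp0 : 0 ≤ p) (hp1 : p ≤ 1) (V : Finset ι)
    {f g : Finset ι → ℝ} (hf : Antitone f) (hg : Monotone g) :
    bernoulliExp p V (fun S => f S * g S) ≤ bernoulliExp p V f * bernoulliExp p V g := by
  have h := bernoulliExp_mul_le_of_monotone hp0 hp1 V hf.neg hg
  simp only [bernoulliExp_neg, neg_mul] at h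
  linarith

/-- The Efron–Stein inequality for functions of a random set. -/
theorem bernoulliExp_efron_stein (hp0 : 0 ≤ p) (hp1 : p ≤ 1) (V : Finset ι)
    (f : Finset ι → ℝ) :
    bernoulliExp p V (fun S => f S ^ 2) - bernoulliExp p V f ^ 2 ≤
      p * (1 - p) * ∑ x ∈ V, bernoulliExp p V (fun S => (f (S.erase x) - f (insert x S)) ^ 2) := by
  induction V using Finset.induction_on generalizing f with
  | empty => simp [bernoulliExp_empty]
  | insert x V hx ih =>
    have hq : 0 ≤ 1 - p := by linarith
    have h0 := ih f
    have h1 := ih (fun S => f (insert x S))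
    have hxx : bernoulliExp p (insert x V) (fun S => (f (S.erase x) - f (insert x S)) ^ 2) =
        bernoulliExp p V (fun S => (f S - f (insert x S)) ^ 2) := by
      rw [bernoulliExp_insert p hx]
      have e1 : bernoulliExp p V (fun S => (f (S.erase x) - f (insert x S)) ^ 2) =
          bernoulliExp p V (fun S => (f S - f (insert x S)) ^ 2) :=
        bernoulliExp_congr p fun S hS => by
          rw [Finset.erase_eq_of_notMem fun h => hx (hS h)]
      have e2 : bernoulliExp p V
            (fun S => (f ((insert x S).erase x) - f (insert x (insert x S))) ^ 2) =
          bernoulliExp p V (fun S => (f S - f (insert x S)) ^ 2) :=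
        bernoulliExp_congr p fun S hS => by
          rw [Finset.erase_insert fun h => hx (hS h), Finset.insert_idem]
      rw [e1, e2]; ring
    have hy : ∑ y ∈ V, bernoulliExp p (insert x V)
          (fun S => (f (S.erase y) - f (insert y S)) ^ 2) =
        (1 - p) * ∑ y ∈ V, bernoulliExp p V (fun S => (f (S.erase y) - f (insert y S)) ^ 2) +
        p * ∑ y ∈ V, bernoulliExp p V
          (fun S => (f (insert x (S.erase y)) - f (insert x (insert y S))) ^ 2) := by
      rw [Finset.mul_sum, Finset.mul_sum, ← Finset.sum_add_distrib]
      refine Finset.sum_congr rfl fun y hyV => ?_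
      have hne : x ≠ y := fun h => hx (h ▸ hyV)
      rw [bernoulliExp_insert p hx]
      simp only [Finset.erase_insert_of_ne hne, Finset.insert_comm y x]
    rw [Finset.sum_insert hx, hxx, hy]
    -- The variance is the mean conditional variance plus `p (1 - p)` times the squared difference
    -- of the two conditional means; Jensen bounds that square by the `x`-term of the sum.
    have hsq := sq_bernoulliExp_le hp0 hp1 V (fun S => f S - f (insert x S))
    rw [bernoulliExp_sub] at hsq
    simp only [bernoulliExp_insert p hx (f := f),
      bernoulliExp_insert p hx (f := fun S => f S ^ 2)]
    have e1 := mul_le_mul_of_nonneg_left h0 hq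
    have e2 := mul_le_mul_of_nonneg_left h1 hp0
    have e3 := mul_le_mul_of_nonneg_left hsq (mul_nonneg hp0 hq)
    nlinarith

/-- The indicator of the event that no member of the family `𝒜` is contained in the random set. -/
noncomputable def avoidInd (𝒜 : Finset (Finset ι)) (S : Finset ι) : ℝ :=
  open Classical in if ∀ A ∈ 𝒜, ¬ A ⊆ S then 1 else 0

theorem avoidInd_nonneg (𝒜 : Finset (Finset ι)) (S : Finset ι) : 0 ≤ avoidInd 𝒜 S := by
  unfold avoidInd; split_ifs <;> norm_num

theorem avoidInd_antitone (𝒜 : Finset (Finset ι)) : Antitone (avoidInd 𝒜) := by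
  intro S S' h
  unfold avoidInd
  by_cases h1 : ∀ A ∈ 𝒜, ¬ A ⊆ S'
  · rw [if_pos h1, if_pos fun A hA hAS => h1 A hA (hAS.trans h)]
  · rw [if_neg h1]; split_ifs <;> norm_num

theorem avoidInd_insert (A : Finset ι) (𝒜 : Finset (Finset ι)) (S : Finset ι) :
    avoidInd (insert A 𝒜) S = (if A ⊆ S then 0 else 1) * avoidInd 𝒜 S := by
  unfold avoidInd
  by_cases h : A ⊆ S <;> simp [h]

/-- Avoiding each single set is a decreasing event, so Harris' inequality can be applied one set at
a time. -/
theorem prod_le_bernoulliExp_avoidInd (hp0 : 0 ≤ p) (hp1 : p ≤ 1) {V : Finset ι}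
    (𝒜 : Finset (Finset ι)) (h𝒜 : ∀ A ∈ 𝒜, A ⊆ V) :
    ∏ A ∈ 𝒜, (1 - p ^ A.card) ≤ bernoulliExp p V (avoidInd 𝒜) := by
  induction 𝒜 using Finset.induction_on with
  | empty =>
    rw [bernoulliExp_congr p (g := fun _ => 1) (fun S _ => by simp [avoidInd]),
      bernoulliExp_const, Finset.prod_empty]
  | insert A 𝒜 hA ih =>
    have ih' := ih fun B hB => h𝒜 B (Finset.mem_insert_of_mem hB)
    have h1 : bernoulliExp p V (fun S => if A ⊆ S then 0 else 1) = 1 - p ^ A.card := by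
      rw [← bernoulliExp_superset (p := p) (h𝒜 A (Finset.mem_insert_self A 𝒜))]
      nth_rewrite 2 [← bernoulliExp_const p V 1]
      rw [← bernoulliExp_sub]
      exact bernoulliExp_congr p fun S _ => by split_ifs <;> norm_num
    have hanti : Antitone fun S : Finset ι => if A ⊆ S then (0 : ℝ) else 1 := by
      intro S S' h
      by_cases h1 : A ⊆ S
      · simp [h1, h1.trans h]
      · simp only [h1, if_false]; split_ifs <;> norm_num
    rw [Finset.prod_insert hA]
    calc _ ≤ (1 - p ^ A.card) * bernoulliExp p V (avoidInd 𝒜) :=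
          mul_le_mul_of_nonneg_left ih' (sub_nonneg.2 (pow_le_one₀ hp0 hp1))
      _ = bernoulliExp p V (fun S => if A ⊆ S then 0 else 1) * bernoulliExp p V (avoidInd 𝒜) := by
          rw [h1]
      _ ≤ _ := bernoulliExp_mul_le_of_antitone hp0 hp1 V hanti (avoidInd_antitone 𝒜)
      _ = _ := bernoulliExp_congr p fun S _ => (avoidInd_insert A 𝒜 S).symm

end BernoulliExp

/-! ### Variance of the number of avoided families. -/

section Variance

variable {ι : Type*} [DecidableEq ι] {p : ℝ}

/-- The indicator of the event that adding `x` to the random set makes it contain a member of `𝒜`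
through `x`. -/
noncomputable def hitInd (𝒜 : Finset (Finset ι)) (x : ι) (S : Finset ι) : ℝ :=
  open Classical in if ∃ A ∈ 𝒜, x ∈ A ∧ A ⊆ insert x S then 1 else 0

theorem hitInd_nonneg (𝒜 : Finset (Finset ι)) (x : ι) (S : Finset ι) : 0 ≤ hitInd 𝒜 x S := by
  unfold hitInd; split_ifs <;> norm_num

theorem hitInd_monotone (𝒜 : Finset (Finset ι)) (x : ι) : Monotone (hitInd 𝒜 x) := by
  intro S S' h
  unfold hitInd
  by_cases h1 : ∃ A ∈ 𝒜, x ∈ A ∧ A ⊆ insert x S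
  · obtain ⟨A, hA, hx, hAS⟩ := h1
    rw [if_pos ⟨A, hA, hx, hAS⟩,
      if_pos ⟨A, hA, hx, hAS.trans (Finset.insert_subset_insert x h)⟩]
  · rw [if_neg h1]; split_ifs <;> norm_num

theorem avoidInd_erase_sub_insert_le (𝒜 : Finset (Finset ι)) (x : ι) (S : Finset ι) :
    avoidInd 𝒜 (S.erase x) - avoidInd 𝒜 (insert x S) ≤
      avoidInd 𝒜 (S.erase x) * hitInd 𝒜 x S := by
  by_cases h : ∀ A ∈ 𝒜, ¬ A ⊆ S.erase x
  · by_cases h' : ∃ A ∈ 𝒜, x ∈ A ∧ A ⊆ insert x S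
    · have h1 : hitInd 𝒜 x S = 1 := if_pos h'
      have h2 := avoidInd_nonneg 𝒜 (insert x S)
      rw [h1]; linarith
    · have h1 : avoidInd 𝒜 (insert x S) = 1 := by
        refine if_pos fun A hA hAS => ?_
        by_cases hx : x ∈ A
        · exact h' ⟨A, hA, hx, hAS⟩
        · refine h A hA fun y hy => Finset.mem_erase.2 ⟨fun e => hx (e ▸ hy), ?_⟩
          exact (Finset.mem_insert.1 (hAS hy)).resolve_left fun e => hx (e ▸ hy)
      have h2 : avoidInd 𝒜 (S.erase x) = 1 := if_pos h
      have h3 := hitInd_nonneg 𝒜 x S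
      rw [h1, h2]; linarith
  · have h1 : avoidInd 𝒜 (S.erase x) = 0 := if_neg h
    have h2 := avoidInd_nonneg 𝒜 (insert x S)
    rw [h1]; linarith

/-- A union bound over pairs of witnesses: both pass through `x`, and the rest of their union
already lies in `S`. -/
theorem hitInd_mul_hitInd_le (𝒜 ℬ : Finset (Finset ι)) (x : ι) (S : Finset ι) :
    hitInd 𝒜 x S * hitInd ℬ x S ≤
      ∑ A ∈ 𝒜, ∑ B ∈ ℬ, if x ∈ A ∩ B then (if (A ∪ B).erase x ⊆ S then (1 : ℝ) else 0) else 0 := by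
  have hnn : ∀ A ∈ 𝒜, ∀ B ∈ ℬ,
      0 ≤ if x ∈ A ∩ B then (if (A ∪ B).erase x ⊆ S then (1 : ℝ) else 0) else 0 := by
    intro A _ B _; split_ifs <;> norm_num
  by_cases h : (∃ A ∈ 𝒜, x ∈ A ∧ A ⊆ insert x S) ∧ ∃ B ∈ ℬ, x ∈ B ∧ B ⊆ insert x S
  · obtain ⟨⟨A, hA, hxA, hAS⟩, ⟨B, hB, hxB, hBS⟩⟩ := h
    have h1 : hitInd 𝒜 x S = 1 := if_pos ⟨A, hA, hxA, hAS⟩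
    have h2 : hitInd ℬ x S = 1 := if_pos ⟨B, hB, hxB, hBS⟩
    rw [h1, h2]
    refine le_trans ?_ (Finset.single_le_sum
      (fun A hA => Finset.sum_nonneg fun B hB => hnn A hA B hB) hA)
    refine le_trans ?_ (Finset.single_le_sum (fun B hB => hnn A hA B hB) hB)
    rw [if_pos (Finset.mem_inter.2 ⟨hxA, hxB⟩),
      if_pos (Finset.subset_insert_iff.1 (Finset.union_subset hAS hBS))]
    norm_num
  · have h0 : hitInd 𝒜 x S * hitInd ℬ x S = 0 := by
      rw [not_and_or] at h
      rcases h with h | h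
      · rw [hitInd, if_neg h, zero_mul]
      · rw [mul_comm, hitInd, if_neg h, zero_mul]
    rw [h0]
    exact Finset.sum_nonneg fun A hA => Finset.sum_nonneg fun B hB => hnn A hA B hB

theorem mul_bernoulliExp_hitInd_le (hp0 : 0 ≤ p) (hp1 : p ≤ 1) {V : Finset ι}
    {𝒜 ℬ : Finset (Finset ι)} (h𝒜 : ∀ A ∈ 𝒜, A ⊆ V) (hℬ : ∀ B ∈ ℬ, B ⊆ V) (x : ι) :
    p * bernoulliExp p V (fun S => hitInd 𝒜 x S * hitInd ℬ x S) ≤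
      ∑ A ∈ 𝒜, ∑ B ∈ ℬ, if x ∈ A ∩ B then p ^ (A ∪ B).card else 0 := by
  refine (mul_le_mul_of_nonneg_left
    (bernoulliExp_mono hp0 hp1 fun S _ => hitInd_mul_hitInd_le 𝒜 ℬ x S) hp0).trans_eq ?_
  rw [bernoulliExp_sum, Finset.mul_sum]
  refine Finset.sum_congr rfl fun A hA => ?_
  rw [bernoulliExp_sum, Finset.mul_sum]
  refine Finset.sum_congr rfl fun B hB => ?_
  by_cases hx : x ∈ A ∩ B
  · simp only [if_pos hx]
    rw [bernoulliExp_superset ((Finset.erase_subset _ _).trans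
      (Finset.union_subset (h𝒜 A hA) (hℬ B hB))), ← pow_succ', Finset.card_erase_add_one
      (Finset.mem_union_left _ (Finset.mem_inter.1 hx).1)]
  · simp only [if_neg hx, bernoulliExp_const, mul_zero]

theorem bernoulliExp_avoidInd_mul_erase_le (hp0 : 0 ≤ p) (hp1 : p ≤ 1) {V : Finset ι}
    (𝒜 ℬ : Finset (Finset ι)) {x : ι} (hx : x ∈ V) :
    (1 - p) * bernoulliExp p V (fun S => avoidInd 𝒜 (S.erase x) * avoidInd ℬ (S.erase x)) ≤
      bernoulliExp p V (fun S => avoidInd 𝒜 S * avoidInd ℬ S) := by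
  rw [bernoulliExp_eq_erase_add_insert hx (fun S => avoidInd 𝒜 S * avoidInd ℬ S)]
  have := bernoulliExp_nonneg hp0 hp1 (V := V.erase x)
    (f := fun S => avoidInd 𝒜 (insert x S) * avoidInd ℬ (insert x S))
    fun S _ => mul_nonneg (avoidInd_nonneg _ _) (avoidInd_nonneg _ _)
  linarith [mul_nonneg hp0 this]

/-- Each difference is at most a decreasing factor (avoidance without `x`) times an increasing one
(`x` completes a member), and Harris' inequality separates them. The factor `1 - p` is spent on
returning from `S.erase x` to `S`, the factor `p` on restoring `x` to `(A ∪ B).erase x`. -/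
theorem bernoulliExp_influence_le (hp0 : 0 ≤ p) (hp1 : p ≤ 1) {V : Finset ι}
    {𝒜 ℬ : Finset (Finset ι)} (h𝒜 : ∀ A ∈ 𝒜, A ⊆ V) (hℬ : ∀ B ∈ ℬ, B ⊆ V) {x : ι}
    (hx : x ∈ V) :
    p * (1 - p) * bernoulliExp p V (fun S =>
        (avoidInd 𝒜 (S.erase x) - avoidInd 𝒜 (insert x S)) *
        (avoidInd ℬ (S.erase x) - avoidInd ℬ (insert x S))) ≤
      bernoulliExp p V (fun S => avoidInd 𝒜 S * avoidInd ℬ S) *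
        ∑ A ∈ 𝒜, ∑ B ∈ ℬ, if x ∈ A ∩ B then p ^ (A ∪ B).card else 0 := by
  have hq : 0 ≤ 1 - p := by linarith
  have hsub : ∀ (𝒞 : Finset (Finset ι)) (S : Finset ι),
      0 ≤ avoidInd 𝒞 (S.erase x) - avoidInd 𝒞 (insert x S) := fun 𝒞 S =>
    sub_nonneg.2 (avoidInd_antitone 𝒞 ((Finset.erase_subset _ _).trans (Finset.subset_insert _ _)))
  have herase : ∀ 𝒞 : Finset (Finset ι), Antitone fun S : Finset ι => avoidInd 𝒞 (S.erase x) :=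
    fun 𝒞 S S' h => avoidInd_antitone 𝒞 (Finset.erase_subset_erase x h)
  have h1 : bernoulliExp p V (fun S =>
        (avoidInd 𝒜 (S.erase x) - avoidInd 𝒜 (insert x S)) *
        (avoidInd ℬ (S.erase x) - avoidInd ℬ (insert x S))) ≤
      bernoulliExp p V (fun S => (avoidInd 𝒜 (S.erase x) * avoidInd ℬ (S.erase x)) *
        (hitInd 𝒜 x S * hitInd ℬ x S)) := by
    refine bernoulliExp_mono hp0 hp1 fun S _ => ?_
    refine (mul_le_mul (avoidInd_erase_sub_insert_le 𝒜 x S) (avoidInd_erase_sub_insert_le ℬ x S)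
      (hsub ℬ S) (mul_nonneg (avoidInd_nonneg _ _) (hitInd_nonneg _ _ _))).trans_eq ?_
    ring
  have h2 := bernoulliExp_mul_le_of_antitone_monotone hp0 hp1 V
    (f := fun S => avoidInd 𝒜 (S.erase x) * avoidInd ℬ (S.erase x))
    (g := fun S => hitInd 𝒜 x S * hitInd ℬ x S)
    (fun S S' h => mul_le_mul (herase 𝒜 h) (herase ℬ h) (avoidInd_nonneg _ _)
      (avoidInd_nonneg _ _))
    (fun S S' h => mul_le_mul (hitInd_monotone 𝒜 x h) (hitInd_monotone ℬ x h)
      (hitInd_nonneg _ _ _) (hitInd_nonneg _ _ _))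
  have h3 := bernoulliExp_avoidInd_mul_erase_le hp0 hp1 𝒜 ℬ hx
  have h4 := mul_bernoulliExp_hitInd_le hp0 hp1 h𝒜 hℬ x
  have h5 : 0 ≤ bernoulliExp p V (fun S => hitInd 𝒜 x S * hitInd ℬ x S) :=
    bernoulliExp_nonneg hp0 hp1 fun S _ => mul_nonneg (hitInd_nonneg _ _ _) (hitInd_nonneg _ _ _)
  have h6 : 0 ≤ bernoulliExp p V (fun S => avoidInd 𝒜 S * avoidInd ℬ S) :=
    bernoulliExp_nonneg hp0 hp1 fun S _ => mul_nonneg (avoidInd_nonneg _ _) (avoidInd_nonneg _ _)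
  calc _ ≤ p * (1 - p) * (bernoulliExp p V
            (fun S => avoidInd 𝒜 (S.erase x) * avoidInd ℬ (S.erase x)) *
          bernoulliExp p V (fun S => hitInd 𝒜 x S * hitInd ℬ x S)) :=
        mul_le_mul_of_nonneg_left (h1.trans h2) (mul_nonneg hp0 hq)
    _ = ((1 - p) * bernoulliExp p V
            (fun S => avoidInd 𝒜 (S.erase x) * avoidInd ℬ (S.erase x))) *
          (p * bernoulliExp p V (fun S => hitInd 𝒜 x S * hitInd ℬ x S)) := by ring
    _ ≤ _ := mul_le_mul h3 h4 (mul_nonneg hp0 h5) h6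

/-- A bound for the variance of the number of families of which no member is contained in the
random set. -/
theorem variance_sum_avoidInd_le (hp0 : 0 ≤ p) (hp1 : p ≤ 1) {V : Finset ι} {γ : Type*}
    (T : Finset γ) (𝒜 : γ → Finset (Finset ι)) (h𝒜 : ∀ g, ∀ A ∈ 𝒜 g, A ⊆ V) :
    bernoulliExp p V (fun S => (∑ g ∈ T, avoidInd (𝒜 g) S) ^ 2) -
        bernoulliExp p V (fun S => ∑ g ∈ T, avoidInd (𝒜 g) S) ^ 2 ≤
      ∑ g ∈ T, ∑ h ∈ T, bernoulliExp p V (fun S => avoidInd (𝒜 g) S * avoidInd (𝒜 h) S) *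
        ∑ A ∈ 𝒜 g, ∑ B ∈ 𝒜 h, (A ∩ B).card * p ^ (A ∪ B).card := by
  refine (bernoulliExp_efron_stein hp0 hp1 V _).trans ?_
  have h1 : ∀ x ∈ V, p * (1 - p) * bernoulliExp p V (fun S =>
      (∑ g ∈ T, avoidInd (𝒜 g) (S.erase x) - ∑ g ∈ T, avoidInd (𝒜 g) (insert x S)) ^ 2) ≤
      ∑ g ∈ T, ∑ h ∈ T, bernoulliExp p V (fun S => avoidInd (𝒜 g) S * avoidInd (𝒜 h) S) *
        ∑ A ∈ 𝒜 g, ∑ B ∈ 𝒜 h, if x ∈ A ∩ B then p ^ (A ∪ B).card else 0 := by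
    intro x hx
    have : ∀ S, (∑ g ∈ T, avoidInd (𝒜 g) (S.erase x) -
          ∑ g ∈ T, avoidInd (𝒜 g) (insert x S)) ^ 2 = ∑ g ∈ T, ∑ h ∈ T,
          (avoidInd (𝒜 g) (S.erase x) - avoidInd (𝒜 g) (insert x S)) *
          (avoidInd (𝒜 h) (S.erase x) - avoidInd (𝒜 h) (insert x S)) := fun S => by
      rw [← Finset.sum_sub_distrib, sq, Finset.sum_mul_sum]
    simp only [this, bernoulliExp_sum, Finset.mul_sum (s := T)]
    exact Finset.sum_le_sum fun g _ => Finset.sum_le_sum fun h _ =>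
      bernoulliExp_influence_le hp0 hp1 (h𝒜 g) (h𝒜 h) hx
  rw [Finset.mul_sum]
  refine (Finset.sum_le_sum h1).trans_eq ?_
  -- Summing over `x` last counts each pair `A`, `B` once for every common element.
  rw [Finset.sum_comm]
  refine Finset.sum_congr rfl fun g _ => ?_
  rw [Finset.sum_comm]
  refine Finset.sum_congr rfl fun h _ => ?_
  rw [← Finset.mul_sum, Finset.sum_comm]
  congr 1
  refine Finset.sum_congr rfl fun A hA => ?_
  rw [Finset.sum_comm]
  refine Finset.sum_congr rfl fun B hB => ?_
  rw [← Finset.sum_filter, Finset.sum_const, nsmul_eq_mul]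
  congr 3
  ext x
  simp only [Finset.mem_filter, Finset.mem_inter, and_iff_right_iff_imp]
  exact fun hx => h𝒜 g A hA hx.1

end Variance

/-! ### Counting representations, and walks in abelian Cayley graphs. -/

section Counting

variable {G : Type*} [CommGroup G] [DecidableEq G]

/-- The product of the elements of `A`, those in `B` being inverted. -/
def signedProd (A B : Finset G) : G := ∏ s ∈ A, if s ∈ B then s⁻¹ else s

theorem signedProd_insert {C : Finset G} {x : G} (hx : x ∉ C) (B : Finset G) :
    signedProd (insert x C) B = (if x ∈ B then x⁻¹ else x) * signedProd C (B ∩ C) := by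
  rw [signedProd, Finset.prod_insert hx, signedProd]
  congr 1
  exact Finset.prod_congr rfl fun s hs => by simp [hs]

variable [Fintype G]

/-- The sets of `d` elements whose product, after inverting some of the elements, is `g`. -/
noncomputable def signedFamily (d : ℕ) (g : G) : Finset (Finset G) :=
  open Classical in Finset.univ.filter fun A => A.card = d ∧ ∃ B ⊆ A, signedProd A B = g

theorem mem_signedFamily {d : ℕ} {g : G} {A : Finset G} :
    A ∈ signedFamily d g ↔ A.card = d ∧ ∃ B ⊆ A, signedProd A B = g := by
  simp [signedFamily]

/-- The one element of `A` outside `C` is determined by the signs on `C` and its own sign. -/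
theorem card_filter_subset_signedFamily_le {k : ℕ} (g : G) {C : Finset G} (hC : C.card = k) :
    ((signedFamily (k + 1) g).filter fun A => C ⊆ A).card ≤ 2 ^ (k + 1) := by
  have hsub : ((signedFamily (k + 1) g).filter fun A => C ⊆ A) ⊆
      (C.powerset ×ˢ (Finset.univ : Finset Bool)).image fun q =>
        insert (if q.2 then (g / signedProd C q.1)⁻¹ else g / signedProd C q.1) C := by
    intro A hA
    obtain ⟨hA, hCA⟩ := Finset.mem_filter.1 hA
    obtain ⟨hcard, B, hBA, hg⟩ := mem_signedFamily.1 hA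
    obtain ⟨x, hx, rfl⟩ := Finset.exists_eq_insert_iff.2 ⟨hCA, by rw [hC, hcard]⟩
    rw [signedProd_insert hx] at hg
    refine Finset.mem_image.2 ⟨(B ∩ C, decide (x ∈ B)), ?_, ?_⟩
    · simp [Finset.inter_subset_right, em]
    · congr 1
      by_cases hxB : x ∈ B
      · simp only [hxB, if_true, decide_true] at hg ⊢
        rw [← hg]; simp
      · simp only [hxB, if_false, decide_false] at hg ⊢
        rw [← hg]; simp
  refine (Finset.card_le_card hsub).trans (Finset.card_image_le.trans ?_)
  rw [Finset.card_product, Finset.card_powerset, hC, Finset.card_univ, Fintype.card_bool, pow_succ]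

/-- Each such `A` contains a `k`-element `C` between `I` and itself; choose `C` freely, then the
last element is nearly forced. -/
theorem card_filter_superset_signedFamily_le {k : ℕ} (g : G) {I : Finset G} (hI : I.card ≤ k) :
    ((signedFamily (k + 1) g).filter fun A => I ⊆ A).card ≤
      2 ^ (k + 1) * Fintype.card G ^ (k - I.card) := by
  set 𝒞 := ((Finset.powersetCard (k - I.card) (Finset.univ : Finset G)).image (I ∪ ·)).filter
    fun C => C.card = k with h𝒞
  have hsub : ((signedFamily (k + 1) g).filter fun A => I ⊆ A) ⊆
      𝒞.biUnion fun C => (signedFamily (k + 1) g).filter fun A => C ⊆ A := by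
    intro A hA
    obtain ⟨hA, hIA⟩ := Finset.mem_filter.1 hA
    obtain ⟨hcard, -⟩ := mem_signedFamily.1 hA
    obtain ⟨C, hIC, hCA, hCk⟩ := Finset.exists_subsuperset_card_eq hIA hI (by omega)
    refine Finset.mem_biUnion.2 ⟨C, ?_, Finset.mem_filter.2 ⟨hA, hCA⟩⟩
    rw [h𝒞, Finset.mem_filter, Finset.mem_image]
    refine ⟨⟨C \ I, ?_, Finset.union_sdiff_of_subset hIC⟩, hCk⟩
    rw [Finset.mem_powersetCard]
    exact ⟨Finset.subset_univ _, by rw [Finset.card_sdiff_of_subset hIC, hCk]⟩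
  refine (Finset.card_le_card hsub).trans ((Finset.card_biUnion_le_card_mul _ _ (2 ^ (k + 1))
    fun C hC => card_filter_subset_signedFamily_le g (Finset.mem_filter.1 hC).2).trans ?_)
  rw [mul_comm]
  refine Nat.mul_le_mul_left _ ((Finset.card_filter_le _ _).trans (Finset.card_image_le.trans ?_))
  rw [Finset.card_powersetCard, Finset.card_univ]
  exact Nat.choose_le_pow _ _

theorem card_signedFamily_le (k : ℕ) (g : G) :
    (signedFamily (k + 1) g).card ≤ 2 ^ (k + 1) * Fintype.card G ^ k := by
  simpa using card_filter_superset_signedFamily_le g (I := ∅) (Nat.zero_le k)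

/-- Double counting of pairs `C ⊆ A` with `C` of size `k`: each `A` has `k + 1` such subsets, each
`C` at most `2 ^ (k + 1)` extensions. The factorial is what makes the threshold constant come out
right. -/
theorem factorial_mul_card_signedFamily_le (k : ℕ) (g : G) :
    (k + 1).factorial * (signedFamily (k + 1) g).card ≤ 2 ^ (k + 1) * Fintype.card G ^ k := by
  have hdc := Finset.sum_card_bipartiteAbove_eq_sum_card_bipartiteBelow
    (s := signedFamily (k + 1) g) (t := Finset.powersetCard k (Finset.univ : Finset G))
    (fun A C => C ⊆ A)
  have h1 : ∀ A ∈ signedFamily (k + 1) g, (Finset.bipartiteAbove (fun A C : Finset G => C ⊆ A)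
      (Finset.powersetCard k Finset.univ) A).card = k + 1 := by
    intro A hA
    have : Finset.bipartiteAbove (fun A C : Finset G => C ⊆ A)
        (Finset.powersetCard k Finset.univ) A = Finset.powersetCard k A := by
      ext C; simp [Finset.bipartiteAbove, Finset.mem_powersetCard, and_comm]
    rw [this, Finset.card_powersetCard, (mem_signedFamily.1 hA).1, Nat.choose_succ_self_right]
  have h2 : ∀ C ∈ Finset.powersetCard k (Finset.univ : Finset G),
      (Finset.bipartiteBelow (fun A C : Finset G => C ⊆ A) (signedFamily (k + 1) g) C).card ≤
        2 ^ (k + 1) := fun C hC =>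
    card_filter_subset_signedFamily_le g (Finset.mem_powersetCard.1 hC).2
  rw [Finset.sum_congr rfl h1, Finset.sum_const, smul_eq_mul] at hdc
  have h3 := Finset.sum_le_card_nsmul _ _ _ h2
  rw [← hdc, Finset.card_powersetCard, Finset.card_univ, smul_eq_mul] at h3
  have h4 : k.factorial * (Fintype.card G).choose k ≤ Fintype.card G ^ k := by
    rw [← Nat.descFactorial_eq_factorial_mul_choose]; exact Nat.descFactorial_le_pow _ _
  calc (k + 1).factorial * (signedFamily (k + 1) g).card
      = k.factorial * ((signedFamily (k + 1) g).card * (k + 1)) := by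
        rw [Nat.factorial_succ]; ring
    _ ≤ k.factorial * ((Fintype.card G).choose k * 2 ^ (k + 1)) := Nat.mul_le_mul_left _ h3
    _ = 2 ^ (k + 1) * (k.factorial * (Fintype.card G).choose k) := by ring
    _ ≤ _ := Nat.mul_le_mul_left _ h4

theorem card_filter_mem_signedFamily_le (d : ℕ) (A : Finset G) (T : Finset G) :
    (T.filter fun h => A ∈ signedFamily d h).card ≤ 2 ^ d := by
  by_cases hA : A.card = d
  · have hsub : (T.filter fun h => A ∈ signedFamily d h) ⊆ A.powerset.image (signedProd A) := by
      intro h hh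
      obtain ⟨-, B, hB, hg⟩ := mem_signedFamily.1 (Finset.mem_filter.1 hh).2
      exact Finset.mem_image.2 ⟨B, Finset.mem_powerset.2 hB, hg⟩
    refine (Finset.card_le_card hsub).trans (Finset.card_image_le.trans ?_)
    rw [Finset.card_powerset, hA]
  · rw [Finset.filter_false_of_mem fun h _ hh => hA (mem_signedFamily.1 hh).1]
    simp

/-- `g` is a product of powers, with exponents at most `d` in absolute value, of elements of `C`. -/
def IsPowerProd (d : ℕ) (C : Finset G) (g : G) : Prop :=
  ∃ c : G → ℤ, (∀ s ∈ C, c s ∈ Finset.Icc (-(d : ℤ)) d) ∧ ∏ s ∈ C, s ^ c s = g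

/-- `g` is a product of powers of fewer than `d` distinct elements of `S`, with exponents at most
`d` in absolute value. -/
def IsDegenerate (d : ℕ) (S : Finset G) (g : G) : Prop :=
  ∃ C ⊆ S, C.card < d ∧ IsPowerProd d C g

open Classical in
theorem card_filter_isPowerProd_le (d : ℕ) (C : Finset G) :
    (Finset.univ.filter (IsPowerProd d C)).card ≤ (2 * d + 1) ^ C.card := by
  have hsub : Finset.univ.filter (IsPowerProd d C) ⊆
      (C.pi fun _ => Finset.Icc (-(d : ℤ)) d).image
        fun c => ∏ s ∈ C.attach, (s : G) ^ c s.1 s.2 := by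
    intro g hg
    obtain ⟨c, hc, rfl⟩ := (Finset.mem_filter.1 hg).2
    refine Finset.mem_image.2 ⟨fun s _ => c s, Finset.mem_pi.2 hc, ?_⟩
    exact Finset.prod_attach C fun s => s ^ c s
  refine (Finset.card_le_card hsub).trans (Finset.card_image_le.trans ?_)
  rw [Finset.card_pi, Finset.prod_const, Int.card_Icc]
  refine Nat.pow_le_pow_left ?_ _
  omega

/-- Look at the support of `c`: fewer than `d` elements give degeneracy, while `d` elements exhaust
the total `d`, which forces every exponent on the support to be `1` or `-1`. -/
theorem isDegenerate_or_exists_signedFamily_subset {d : ℕ} {S : Finset G} {c : G → ℤ}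
    (hc : ∑ s, (c s).natAbs ≤ d) (hS : ∀ s, c s ≠ 0 → s ∈ S) :
    IsDegenerate d S (∏ s, s ^ c s) ∨ ∃ A ∈ signedFamily d (∏ s, s ^ c s), A ⊆ S := by
  set A := Finset.univ.filter fun s => c s ≠ 0 with hA
  have hAS : A ⊆ S := fun s hs => hS s (Finset.mem_filter.1 hs).2
  have hprod : ∏ s ∈ A, s ^ c s = ∏ s, s ^ c s := by
    rw [hA, Finset.prod_filter]
    refine Finset.prod_congr rfl fun s _ => ?_
    by_cases h : c s = 0 <;> simp [h]
  have hsum : ∑ s ∈ A, (c s).natAbs ≤ d :=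
    (Finset.sum_le_sum_of_subset (Finset.subset_univ A)).trans hc
  have hpos : ∀ s ∈ A, 1 ≤ (c s).natAbs := fun s hs =>
    Int.natAbs_pos.2 (Finset.mem_filter.1 hs).2
  have hle : ∀ s, (c s).natAbs ≤ d := fun s =>
    (Finset.single_le_sum (f := fun s => (c s).natAbs) (fun _ _ => Nat.zero_le _)
      (Finset.mem_univ s)).trans hc
  rcases lt_or_ge A.card d with hlt | hge
  · refine Or.inl ⟨A, hAS, hlt, c, fun s _ => ?_, hprod⟩
    have := hle s
    rw [Finset.mem_Icc]; omega
  · refine Or.inr ⟨A, ?_, hAS⟩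
    have hcard : A.card ≤ ∑ s ∈ A, (c s).natAbs := by
      simpa using Finset.card_nsmul_le_sum A _ 1 hpos
    have hone : ∀ s ∈ A, 1 = (c s).natAbs := by
      refine (Finset.sum_eq_sum_iff_of_le hpos).1 ?_
      rw [Finset.sum_const, smul_eq_mul, mul_one]; omega
    refine mem_signedFamily.2 ⟨by omega, A.filter fun s => c s < 0, Finset.filter_subset _ _, ?_⟩
    rw [← hprod, signedProd]
    refine Finset.prod_congr rfl fun s hs => ?_
    have h1 := hone s hs
    by_cases hneg : c s < 0
    · have : c s = -1 := by omega
      simp [hs, this]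
    · have : c s = 1 := by omega
      simp [this]

/-- Each edge multiplies by a generator or its inverse; commutativity lets its exponent be merged
into those collected from the rest of the walk. -/
theorem exists_exponents_of_walk {S : Finset G} {u v : G}
    (w : (SimpleGraph.mulCayley (S : Set G)).Walk u v) :
    ∃ c : G → ℤ, ∑ s, (c s).natAbs ≤ w.length ∧ (∀ s, c s ≠ 0 → s ∈ S) ∧
      v = u * ∏ s, s ^ c s := by
  induction w with
  | nil => exact ⟨0, by simp⟩
  | @cons u w' v h w ih =>
    obtain ⟨c, hc, hS, hv⟩ := ih
    obtain ⟨-, x, hx, hux⟩ := (SimpleGraph.mulCayley_adj' _ _ _).1 h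
    have key : ∀ e : ℤ, e.natAbs = 1 → w' = u * x ^ e →
        ∃ c : G → ℤ, ∑ s, (c s).natAbs ≤ (SimpleGraph.Walk.cons h w).length ∧
          (∀ s, c s ≠ 0 → s ∈ S) ∧ v = u * ∏ s, s ^ c s := by
      intro e he hw
      refine ⟨fun s => c s + Pi.single (M := fun _ => ℤ) x e s, ?_, ?_, ?_⟩
      · calc ∑ s, (c s + Pi.single (M := fun _ => ℤ) x e s).natAbs
            ≤ ∑ s, ((c s).natAbs + (Pi.single (M := fun _ => ℤ) x e s).natAbs) :=
              Finset.sum_le_sum fun s _ => Int.natAbs_add_le _ _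
          _ = ∑ s, (c s).natAbs + 1 := by
              rw [Finset.sum_add_distrib]
              congr 1
              rw [Finset.sum_eq_single x]
              · simp [he]
              · intro s _ hs; simp [hs]
              · simp
          _ ≤ _ := by rw [SimpleGraph.Walk.length_cons]; omega
      · intro s hs
        by_cases hsx : s = x
        · subst hsx; simpa using hx
        · exact hS s (by simpa [hsx] using hs)
      · have : ∏ s, s ^ (c s + Pi.single (M := fun _ => ℤ) x e s) =
            (∏ s, s ^ c s) * x ^ e := by
          simp only [zpow_add, Finset.prod_mul_distrib]
          congr 1
          rw [Finset.prod_eq_single x]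
          · simp
          · intro s _ hs; simp [hs]
          · simp
        rw [this, hv, hw]
        simp only [mul_assoc, mul_comm]
    rcases hux with h1 | h1
    · exact key 1 rfl (by simp [h1])
    · exact key (-1) rfl (by simp [h1])

/-- If some element is neither degenerate nor a signed product of distinct generators, then the
diameter of the Cayley graph is large. -/
theorem lt_ediam_mulCayley {d : ℕ} {S : Finset G} {g : G} (hdeg : ¬ IsDegenerate d S g)
    (hfam : ∀ A ∈ signedFamily d g, ¬ A ⊆ S) :
    (d : ℕ∞) < (SimpleGraph.mulCayley (S : Set G)).ediam := by
  by_contra! hle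
  have hdist : (SimpleGraph.mulCayley (S : Set G)).edist 1 g ≤ d :=
    SimpleGraph.edist_le_ediam.trans hle
  obtain ⟨w, hw⟩ := SimpleGraph.exists_walk_of_edist_ne_top
    (ne_top_of_le_ne_top (ENat.natCast_ne_top d) hdist)
  rw [← hw] at hdist
  obtain ⟨c, hc, hS, hg⟩ := exists_exponents_of_walk w
  rw [one_mul] at hg
  have hlen : w.length ≤ d := by exact_mod_cast hdist
  rcases isDegenerate_or_exists_signedFamily_subset (hc.trans hlen) hS with h | ⟨A, hA, hAS⟩
  · exact hdeg (hg ▸ h)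
  · exact hfam A (hg ▸ hA) hAS

end Counting

/-! ### Second-moment and degeneracy estimates for signed families. -/

section SecondMoment

/-- Used with `Q = N p` and `r = N^(1/d)`: the bound on the `d`-th power passes to other exponents
at the cost of only a power of `L`. -/
theorem pow_le_of_pow_le_mul {Q r L : ℝ} {d m e : ℕ} (hQ : 0 ≤ Q) (hr : 0 < r) (hL : 1 ≤ L)
    (h : Q ^ d ≤ r ^ d * L) (hm : m ≤ e * d) : Q ^ m ≤ r ^ m * L ^ e := by
  have hy : 0 ≤ Q / r := by positivity
  have hyd : (Q / r) ^ d ≤ L := by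
    rw [div_pow, div_le_iff₀ (by positivity)]; linarith
  have key : (Q / r) ^ m ≤ L ^ e := by
    rcases le_total (Q / r) 1 with h1 | h1
    · exact (pow_le_one₀ hy h1).trans (one_le_pow₀ hL)
    · calc (Q / r) ^ m ≤ (Q / r) ^ (e * d) := pow_le_pow_right₀ h1 hm
        _ = ((Q / r) ^ d) ^ e := by rw [mul_comm, pow_mul]
        _ ≤ L ^ e := pow_le_pow_left₀ (by positivity) hyd e
  rw [div_pow, div_le_iff₀ (by positivity)] at key
  linarith

variable {G : Type*} [CommGroup G]

/-- The indicator of the event that `g` is degenerate. -/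
noncomputable def degenerateInd (d : ℕ) (g : G) (S : Finset G) : ℝ :=
  open Classical in if IsDegenerate d S g then 1 else 0

theorem degenerateInd_monotone (d : ℕ) (g : G) : Monotone (degenerateInd d g) := by
  intro S S' h
  unfold degenerateInd
  by_cases h1 : IsDegenerate d S g
  · obtain ⟨C, hC, h2⟩ := h1
    rw [if_pos ⟨C, hC, h2⟩, if_pos ⟨C, hC.trans h, h2⟩]
  · rw [if_neg h1]; split_ifs <;> norm_num

theorem degenerateInd_nonneg (d : ℕ) (g : G) (S : Finset G) : 0 ≤ degenerateInd d g S := by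
  unfold degenerateInd; split_ifs <;> norm_num

variable [DecidableEq G] [Fintype G] {p r L μ : ℝ} {k : ℕ}

/-- Sort the `B` by `I = A ∩ B`, then relax this to `I ⊆ B`. Disjoint pairs contribute nothing, and
`B ≠ A` of equal size forces `I.card ≤ k`. -/
theorem sum_inter_signedFamily_le (hp0 : 0 ≤ p) (h : G) {A : Finset G} (hA : A.card = k + 1) :
    ∑ B ∈ (signedFamily (k + 1) h).filter (· ≠ A), ((A ∩ B).card : ℝ) * p ^ (A ∪ B).card ≤
      ∑ I ∈ A.powerset.filter (fun I => 1 ≤ I.card ∧ I.card ≤ k),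
        2 ^ (k + 1) * (Fintype.card G : ℝ) ^ (k - I.card) *
          ((k + 1 : ℕ) * p ^ (2 * (k + 1) - I.card)) := by
  have h1 : ∀ B ∈ (signedFamily (k + 1) h).filter (· ≠ A),
      ((A ∩ B).card : ℝ) * p ^ (A ∪ B).card ≤
      ∑ I ∈ A.powerset.filter (fun I => 1 ≤ I.card ∧ I.card ≤ k),
        if I ⊆ B then ((k + 1 : ℕ) * p ^ (2 * (k + 1) - I.card) : ℝ) else 0 := by
    intro B hB
    obtain ⟨hB, hne⟩ := Finset.mem_filter.1 hB
    have hBc := (mem_signedFamily.1 hB).1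
    have hnn : ∀ I ∈ A.powerset.filter (fun I => 1 ≤ I.card ∧ I.card ≤ k),
        0 ≤ if I ⊆ B then ((k + 1 : ℕ) * p ^ (2 * (k + 1) - I.card) : ℝ) else 0 := by
      intro I _; split_ifs <;> positivity
    rcases Nat.eq_zero_or_pos (A ∩ B).card with h0 | hpos
    · rw [h0]; simpa using Finset.sum_nonneg hnn
    · have hcard := Finset.card_union_add_card_inter A B
      have hle : (A ∩ B).card ≤ k := by
        by_contra! hlt
        have e1 : A ∩ B = A := Finset.eq_of_subset_of_card_le Finset.inter_subset_left (by omega)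
        have e2 : A ∩ B = B := Finset.eq_of_subset_of_card_le Finset.inter_subset_right (by omega)
        exact hne (e2.symm.trans e1)
      have hmem : A ∩ B ∈ A.powerset.filter (fun I => 1 ≤ I.card ∧ I.card ≤ k) := by
        rw [Finset.mem_filter, Finset.mem_powerset]
        exact ⟨Finset.inter_subset_left, hpos, hle⟩
      refine le_trans ?_ (Finset.single_le_sum hnn hmem)
      rw [if_pos Finset.inter_subset_right]
      have : (A ∪ B).card = 2 * (k + 1) - (A ∩ B).card := by omega
      rw [this]
      refine mul_le_mul_of_nonneg_right ?_ (by positivity)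
      exact_mod_cast hle.trans (Nat.le_succ k)
  refine (Finset.sum_le_sum h1).trans ?_
  rw [Finset.sum_comm]
  refine Finset.sum_le_sum fun I hI => ?_
  obtain ⟨-, -, hIk⟩ := Finset.mem_filter.1 hI
  rw [← Finset.sum_filter, Finset.sum_const, nsmul_eq_mul]
  refine mul_le_mul_of_nonneg_right ?_ (by positivity)
  exact_mod_cast (Finset.card_le_card (Finset.filter_subset_filter _
    (Finset.filter_subset _ _))).trans (card_filter_superset_signedFamily_le h hIk)

theorem sum_sum_inter_signedFamily_le (hp0 : 0 ≤ p) (hr : 1 ≤ r)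
    (hrN : r ^ (k + 1) = Fintype.card G) (hL : 1 ≤ L)
    (hQ : (Fintype.card G * p) ^ (k + 1) ≤ Fintype.card G * L) (g h : G) :
    ∑ A ∈ signedFamily (k + 1) g, ∑ B ∈ (signedFamily (k + 1) h).filter (· ≠ A),
      ((A ∩ B).card : ℝ) * p ^ (A ∪ B).card ≤ (k + 1 : ℕ) * 8 ^ (k + 1) * L ^ 2 / r := by
  have hr0 : 0 < r := by linarith
  set N : ℝ := (Fintype.card G : ℝ) with hN
  have hN0 : 0 < N := by rw [← hrN]; positivity
  have hterm : ∀ j, 1 ≤ j → j ≤ k → (2 ^ (k + 1) * N ^ k) * (2 ^ (k + 1) * N ^ (k - j) *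
      ((k + 1 : ℕ) * p ^ (2 * (k + 1) - j))) ≤ 4 ^ (k + 1) * (k + 1 : ℕ) * (L ^ 2 / r) := by
    intro j hj1 hjk
    have hQ' := pow_le_of_pow_le_mul (m := 2 * (k + 1) - j) (e := 2) (by positivity) hr0 hL
      (hQ.trans_eq (by rw [hrN])) (Nat.sub_le _ _)
    -- Here `1 ≤ j` is essential: a common element saves the factor `r = N^(1/d)`.
    have h2 : r ^ (2 * (k + 1) - j) * r ≤ N ^ 2 := by
      rw [← pow_succ, ← hrN, ← pow_mul]
      exact pow_le_pow_right₀ hr (by omega)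
    have h3 : N ^ k * N ^ (k - j) * p ^ (2 * (k + 1) - j) ≤ L ^ 2 / r := by
      rw [le_div_iff₀ hr0]
      have h4 : N ^ 2 * (N ^ k * N ^ (k - j) * p ^ (2 * (k + 1) - j)) =
          (N * p) ^ (2 * (k + 1) - j) := by
        rw [mul_pow, ← mul_assoc, ← pow_add, ← pow_add]
        congr 2
        omega
      have h5 : N ^ 2 * (N ^ k * N ^ (k - j) * p ^ (2 * (k + 1) - j) * r) ≤ N ^ 2 * L ^ 2 := by
        rw [← mul_assoc, h4]
        calc _ ≤ r ^ (2 * (k + 1) - j) * L ^ 2 * r := mul_le_mul_of_nonneg_right hQ' hr0.le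
          _ = (r ^ (2 * (k + 1) - j) * r) * L ^ 2 := by ring
          _ ≤ _ := mul_le_mul_of_nonneg_right h2 (by positivity)
      exact le_of_mul_le_mul_left h5 (by positivity)
    calc _ = (2 ^ (k + 1) * 2 ^ (k + 1) * ((k + 1 : ℕ) : ℝ)) *
          (N ^ k * N ^ (k - j) * p ^ (2 * (k + 1) - j)) := by ring
      _ ≤ (2 ^ (k + 1) * 2 ^ (k + 1) * ((k + 1 : ℕ) : ℝ)) * (L ^ 2 / r) :=
          mul_le_mul_of_nonneg_left h3 (by positivity)
      _ = _ := by rw [← mul_pow]; norm_num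
  -- The prefactor bounds the number of rows `A`, so each row is compared with its share of the
  -- total.
  have hrow : ∀ A ∈ signedFamily (k + 1) g,
      (2 ^ (k + 1) * N ^ k) * ∑ B ∈ (signedFamily (k + 1) h).filter (· ≠ A),
        ((A ∩ B).card : ℝ) * p ^ (A ∪ B).card ≤ (k + 1 : ℕ) * 8 ^ (k + 1) * L ^ 2 / r := by
    intro A hA
    have hAc := (mem_signedFamily.1 hA).1
    refine (mul_le_mul_of_nonneg_left (sum_inter_signedFamily_le hp0 h hAc)
      (by positivity)).trans ?_
    rw [Finset.mul_sum]
    refine (Finset.sum_le_card_nsmul _ _ (4 ^ (k + 1) * (k + 1 : ℕ) * (L ^ 2 / r))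
      fun I hI => ?_).trans ?_
    · obtain ⟨-, h1, h2⟩ := Finset.mem_filter.1 hI
      exact hterm _ h1 h2
    · rw [nsmul_eq_mul]
      have hc : ((A.powerset.filter (fun I => 1 ≤ I.card ∧ I.card ≤ k)).card : ℝ) ≤
          2 ^ (k + 1) := by
        have := Finset.card_filter_le A.powerset (fun I => 1 ≤ I.card ∧ I.card ≤ k)
        rw [Finset.card_powerset, hAc] at this
        exact_mod_cast this
      refine (mul_le_mul_of_nonneg_right hc (by positivity)).trans_eq ?_
      have : (8 : ℝ) ^ (k + 1) = 2 ^ (k + 1) * 4 ^ (k + 1) := by rw [← mul_pow]; norm_num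
      rw [this]; ring
  have hcard : ((signedFamily (k + 1) g).card : ℝ) ≤ 2 ^ (k + 1) * N ^ k := by
    rw [hN]; exact_mod_cast card_signedFamily_le k g
  have hM : 0 < (2 : ℝ) ^ (k + 1) * N ^ k := by positivity
  refine (Finset.sum_le_card_nsmul _ _ (((k + 1 : ℕ) * 8 ^ (k + 1) * L ^ 2 / r) /
    (2 ^ (k + 1) * N ^ k)) fun A hA => ?_).trans ?_
  · rw [le_div_iff₀ hM, mul_comm]; exact hrow A hA
  · rw [nsmul_eq_mul]
    refine (mul_le_mul_of_nonneg_right hcard (by positivity)).trans_eq ?_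
    field_simp

/-- The variance of the number of elements of `T` that are not signed products of `k + 1` distinct
elements of the random set. -/
theorem variance_sum_avoidInd_signedFamily_le (hp0 : 0 ≤ p) (hp1 : p ≤ 1) (hr : 1 ≤ r)
    (hrN : r ^ (k + 1) = Fintype.card G) (hL : 1 ≤ L)
    (hQ : (Fintype.card G * p) ^ (k + 1) ≤ Fintype.card G * L)
    (hμ : ∀ g : G, (signedFamily (k + 1) g).card * p ^ (k + 1) ≤ μ) (T : Finset G) :
    bernoulliExp p Finset.univ (fun S => (∑ g ∈ T, avoidInd (signedFamily (k + 1) g) S) ^ 2) -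
        bernoulliExp p Finset.univ (fun S => ∑ g ∈ T, avoidInd (signedFamily (k + 1) g) S) ^ 2 ≤
      (k + 1 : ℕ) * 2 ^ (k + 1) * μ *
        bernoulliExp p Finset.univ (fun S => ∑ g ∈ T, avoidInd (signedFamily (k + 1) g) S) +
      (k + 1 : ℕ) * 8 ^ (k + 1) * L ^ 2 / r *
        bernoulliExp p Finset.univ
          (fun S => (∑ g ∈ T, avoidInd (signedFamily (k + 1) g) S) ^ 2) := by
  set F := fun g : G => signedFamily (k + 1) g with hF
  set E2 := fun g h : G =>
    bernoulliExp p Finset.univ (fun S => avoidInd (F g) S * avoidInd (F h) S) with hE2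
  set δ := (k + 1 : ℕ) * 8 ^ (k + 1) * L ^ 2 / r with hδ
  have hE2nn : ∀ g h, 0 ≤ E2 g h := fun g h =>
    bernoulliExp_nonneg hp0 hp1 fun S _ => mul_nonneg (avoidInd_nonneg _ _) (avoidInd_nonneg _ _)
  have hE2le : ∀ g h, E2 g h ≤ bernoulliExp p Finset.univ (avoidInd (F g)) := fun g h =>
    bernoulliExp_mono hp0 hp1 fun S _ => by
      refine mul_le_of_le_one_right (avoidInd_nonneg _ _) ?_
      unfold avoidInd; split_ifs <;> norm_num
  have hsq : bernoulliExp p Finset.univ (fun S => (∑ g ∈ T, avoidInd (F g) S) ^ 2) =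
      ∑ g ∈ T, ∑ h ∈ T, E2 g h := by
    simp only [hE2, sq, Finset.sum_mul_sum, bernoulliExp_sum]
  refine (variance_sum_avoidInd_le hp0 hp1 T F fun g A _ => Finset.subset_univ A).trans ?_
  -- The diagonal `B = A` is kept apart: it is not small for each pair `g`, `h`, only after summing
  -- over `h`, since one set represents at most `2 ^ (k + 1)` elements.
  have hsplit : ∀ g h, ∑ A ∈ F g, ∑ B ∈ F h, ((A ∩ B).card : ℝ) * p ^ (A ∪ B).card ≤
      (∑ A ∈ F g, if A ∈ F h then ((k + 1 : ℕ) * p ^ (k + 1) : ℝ) else 0) + δ := by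
    intro g h
    refine le_trans (le_of_eq ?_) (add_le_add_right
      (sum_sum_inter_signedFamily_le hp0 hr hrN hL hQ g h) _)
    rw [← Finset.sum_add_distrib]
    refine Finset.sum_congr rfl fun A hA => ?_
    rw [← Finset.sum_filter_add_sum_filter_not (F h) (fun B => B = A)]
    congr 1
    rw [Finset.sum_filter, Finset.sum_ite_eq' (F h) A]
    simp [(mem_signedFamily.1 hA).1]
  have hdiag : ∀ g, ∑ h ∈ T, ∑ A ∈ F g, (if A ∈ F h then ((k + 1 : ℕ) * p ^ (k + 1) : ℝ) else 0) ≤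
      (k + 1 : ℕ) * 2 ^ (k + 1) * μ := by
    intro g
    rw [Finset.sum_comm]
    refine (Finset.sum_le_card_nsmul _ _ (2 ^ (k + 1) * ((k + 1 : ℕ) * p ^ (k + 1)))
      fun A hA => ?_).trans ?_
    · rw [← Finset.sum_filter, Finset.sum_const, nsmul_eq_mul]
      refine mul_le_mul_of_nonneg_right ?_ (by positivity)
      exact_mod_cast card_filter_mem_signedFamily_le (k + 1) A T
    · rw [nsmul_eq_mul]
      calc _ = (k + 1 : ℕ) * 2 ^ (k + 1) * ((F g).card * p ^ (k + 1)) := by ring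
        _ ≤ _ := mul_le_mul_of_nonneg_left (hμ g) (by positivity)
  rw [hsq, bernoulliExp_sum, Finset.mul_sum, Finset.mul_sum, ← Finset.sum_add_distrib]
  refine Finset.sum_le_sum fun g _ => ?_
  calc _ ≤ ∑ h ∈ T, (bernoulliExp p Finset.univ (avoidInd (F g)) *
          (∑ A ∈ F g, if A ∈ F h then ((k + 1 : ℕ) * p ^ (k + 1) : ℝ) else 0) + E2 g h * δ) := by
        refine Finset.sum_le_sum fun h _ => ?_
        refine (mul_le_mul_of_nonneg_left (hsplit g h) (hE2nn g h)).trans ?_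
        rw [mul_add]
        refine add_le_add_left (mul_le_mul_of_nonneg_right (hE2le g h) ?_) _
        exact Finset.sum_nonneg fun A _ => by split_ifs <;> positivity
    _ = bernoulliExp p Finset.univ (avoidInd (F g)) * (∑ h ∈ T,
          ∑ A ∈ F g, if A ∈ F h then ((k + 1 : ℕ) * p ^ (k + 1) : ℝ) else 0) +
          δ * ∑ h ∈ T, E2 g h := by
        rw [Finset.sum_add_distrib, Finset.mul_sum, ← Finset.sum_mul, mul_comm δ]
    _ ≤ _ := by
        refine add_le_add_left ?_ _
        rw [mul_comm]
        exact mul_le_mul_of_nonneg_right (hdiag g)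
          (bernoulliExp_nonneg hp0 hp1 fun S _ => avoidInd_nonneg _ _)

/-- The expected number of degenerate elements. -/
theorem sum_bernoulliExp_degenerateInd_le (hp0 : 0 ≤ p) (hp1 : p ≤ 1) (hr : 1 ≤ r)
    (hrN : r ^ (k + 1) = Fintype.card G) (hL : 1 ≤ L)
    (hQ : (Fintype.card G * p) ^ (k + 1) ≤ Fintype.card G * L) :
    ∑ g : G, bernoulliExp p Finset.univ (degenerateInd (k + 1) g) ≤
      Fintype.card G * ((k + 1 : ℕ) * (2 * (k + 1 : ℕ) + 1) ^ (k + 1) * L / r) := by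
  classical
  have hr0 : 0 < r := by linarith
  set N : ℝ := (Fintype.card G : ℝ) with hN
  have hN0 : 0 < N := by rw [← hrN]; positivity
  set b : ℝ := 2 * (k + 1 : ℕ) + 1 with hb
  have hb1 : 1 ≤ b := by rw [hb]; linarith [Nat.cast_nonneg (α := ℝ) (k + 1)]
  set 𝒞 := Finset.univ.filter fun C : Finset G => C.card < k + 1 with h𝒞
  -- Union bound over the supports `C`. After summing over `g`, each `C` accounts for at most `b ^
  -- C.card` elements, one per exponent vector.
  have h1 : ∀ g : G, bernoulliExp p Finset.univ (degenerateInd (k + 1) g) ≤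
      ∑ C ∈ 𝒞, if IsPowerProd (k + 1) C g then p ^ C.card else 0 := by
    intro g
    have h2 : bernoulliExp p Finset.univ (degenerateInd (k + 1) g) ≤
        bernoulliExp p Finset.univ (fun S => ∑ C ∈ 𝒞,
          (if IsPowerProd (k + 1) C g then (1 : ℝ) else 0) * if C ⊆ S then 1 else 0) := by
      refine bernoulliExp_mono hp0 hp1 fun S _ => ?_
      have hnn : ∀ C ∈ 𝒞, 0 ≤ (if IsPowerProd (k + 1) C g then (1 : ℝ) else 0) *
          if C ⊆ S then 1 else 0 := by
        intro C _; split_ifs <;> norm_num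
      unfold degenerateInd
      split_ifs with hd
      · obtain ⟨C, hCS, hCk, hC⟩ := hd
        refine le_trans ?_ (Finset.single_le_sum hnn
          (Finset.mem_filter.2 ⟨Finset.mem_univ C, hCk⟩))
        rw [if_pos hC, if_pos hCS]; norm_num
      · exact Finset.sum_nonneg hnn
    refine h2.trans_eq ?_
    rw [bernoulliExp_sum]
    refine Finset.sum_congr rfl fun C _ => ?_
    rw [bernoulliExp_const_mul, bernoulliExp_superset (Finset.subset_univ C)]
    split_ifs <;> simp
  refine (Finset.sum_le_sum fun g _ => h1 g).trans ?_
  rw [Finset.sum_comm]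
  have h3 : ∀ C ∈ 𝒞, ∑ g : G, (if IsPowerProd (k + 1) C g then p ^ C.card else 0) ≤
      (b * p) ^ C.card := by
    intro C _
    rw [← Finset.sum_filter, Finset.sum_const, nsmul_eq_mul, mul_pow]
    refine mul_le_mul_of_nonneg_right ?_ (by positivity)
    have := card_filter_isPowerProd_le (k + 1) C
    rw [hb]; exact_mod_cast this
  refine (Finset.sum_le_sum h3).trans ?_
  have h4 : ∑ C ∈ 𝒞, (b * p) ^ C.card =
      ∑ j ∈ Finset.range (k + 1), (Fintype.card G).choose j * (b * p) ^ j := by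
    rw [← Finset.sum_fiberwise_of_maps_to (s := 𝒞) (t := Finset.range (k + 1)) (g := Finset.card)
      fun C hC => Finset.mem_range.2 (Finset.mem_filter.1 hC).2]
    refine Finset.sum_congr rfl fun j hj => ?_
    have : 𝒞.filter (fun C => C.card = j) = Finset.powersetCard j Finset.univ := by
      ext C
      have := Finset.mem_range.1 hj
      simp only [h𝒞, Finset.mem_filter, Finset.mem_univ, true_and, Finset.mem_powersetCard,
        Finset.subset_univ]
      omega
    rw [this, Finset.sum_congr rfl fun C hC => by rw [(Finset.mem_powersetCard.1 hC).2],
      Finset.sum_const, Finset.card_powersetCard, Finset.card_univ, nsmul_eq_mul]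
  rw [h4]
  refine (Finset.sum_le_card_nsmul _ _ (b ^ (k + 1) * (N * L / r)) fun j hj => ?_).trans_eq ?_
  · have hjk : j ≤ k := Nat.lt_succ_iff.1 (Finset.mem_range.1 hj)
    have hQ' := pow_le_of_pow_le_mul (m := j) (e := 1) (by positivity) hr0 hL
      (hQ.trans_eq (by rw [hrN])) (by omega)
    have hch : ((Fintype.card G).choose j : ℝ) ≤ N ^ j := by
      rw [hN]; exact_mod_cast Nat.choose_le_pow _ _
    -- Having fewer than `d` generators leaves a spare factor `r`.
    have hrj : r ^ j ≤ N / r := by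
      rw [le_div_iff₀ hr0, ← pow_succ, ← hrN]
      exact pow_le_pow_right₀ hr (by omega)
    calc _ ≤ N ^ j * (b * p) ^ j := mul_le_mul_of_nonneg_right hch (by positivity)
      _ = b ^ j * (N * p) ^ j := by rw [mul_pow, mul_pow]; ring
      _ ≤ b ^ (k + 1) * (N * L / r) := by
          refine mul_le_mul (pow_le_pow_right₀ hb1 (by omega)) ?_ (by positivity) (by positivity)
          rw [pow_one] at hQ'
          refine hQ'.trans ((mul_le_mul_of_nonneg_right hrj (by positivity)).trans_eq ?_)
          ring
  · rw [Finset.card_range, nsmul_eq_mul]; ring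

end SecondMoment

/-! ### The second moment method for the diameter. -/

section Diameter

variable {G : Type*} [CommGroup G] [DecidableEq G] [Fintype G] {p r L μ q w : ℝ} {k : ℕ}

/-- If the diameter is at most `d`, then the number of elements of `T` that are not signed products
of `d` distinct generators is far from `m`, or many of them are degenerate. -/
theorem one_le_ediam_indicator_add {d : ℕ} (T : Finset G) {m : ℝ} (hm : 0 < m) (S : Finset G) :
    1 ≤ (open Classical in if (d : ℕ∞) < (SimpleGraph.mulCayley (S : Set G)).ediam
        then (1 : ℝ) else 0) +
      (4 / m ^ 2 * (∑ g ∈ T, avoidInd (signedFamily d g) S - m) ^ 2 +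
        2 / m * ∑ g ∈ T, avoidInd (signedFamily d g) S * degenerateInd d g S) := by
  have hnn1 : 0 ≤ 4 / m ^ 2 * (∑ g ∈ T, avoidInd (signedFamily d g) S - m) ^ 2 := by positivity
  have hnn2 : 0 ≤ 2 / m * ∑ g ∈ T, avoidInd (signedFamily d g) S * degenerateInd d g S :=
    mul_nonneg (by positivity) (Finset.sum_nonneg fun g _ =>
      mul_nonneg (avoidInd_nonneg _ _) (degenerateInd_nonneg _ _ _))
  by_cases h : (d : ℕ∞) < (SimpleGraph.mulCayley (S : Set G)).ediam
  · rw [if_pos h]; linarith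
  · rw [if_neg h]
    have heq : ∑ g ∈ T, avoidInd (signedFamily d g) S * degenerateInd d g S =
        ∑ g ∈ T, avoidInd (signedFamily d g) S := by
      refine Finset.sum_congr rfl fun g _ => ?_
      by_cases h1 : ∀ A ∈ signedFamily d g, ¬ A ⊆ S
      · by_cases h2 : IsDegenerate d S g
        · rw [degenerateInd, if_pos h2, mul_one]
        · exact absurd (lt_ediam_mulCayley h2 h1) h
      · rw [avoidInd, if_neg h1, zero_mul]
    rw [heq] at hnn2 ⊢
    set X := ∑ g ∈ T, avoidInd (signedFamily d g) S
    -- Every missed element of `T` is degenerate here: a large `X` makes the degenerate term at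
    -- least `1`, a small `X` makes the Chebyshev term at least `1`.
    rcases le_total (m / 2) X with h1 | h1
    · have : 1 ≤ 2 / m * X := by
        rw [div_mul_eq_mul_div, le_div_iff₀ hm]; linarith
      linarith
    · have : 1 ≤ 4 / m ^ 2 * (X - m) ^ 2 := by
        rw [div_mul_eq_mul_div, le_div_iff₀ (by positivity)]
        nlinarith
      linarith

/-- A lower bound for the probability that the diameter exceeds `k + 1`, by the second moment
method. -/
theorem bernoulliExp_lt_ediam_ge (hp0 : 0 ≤ p) (hp1 : p ≤ 1) (hr : 1 ≤ r)
    (hrN : r ^ (k + 1) = Fintype.card G) (hL : 1 ≤ L)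
    (hQ : (Fintype.card G * p) ^ (k + 1) ≤ Fintype.card G * L)
    (hμ0 : 0 ≤ μ) (hμ : ∀ g : G, (signedFamily (k + 1) g).card * p ^ (k + 1) ≤ μ)
    (hq : 0 < q) (hqd : (k + 1 : ℕ) * (2 * (k + 1 : ℕ) + 1) ^ (k + 1) * L / r ≤ q / 2)
    (hδ : (k + 1 : ℕ) * 8 ^ (k + 1) * L ^ 2 / r ≤ 1 / 2)
    (hw : 0 < w)
    (hwg : ∀ g : G, w ≤ bernoulliExp p Finset.univ (avoidInd (signedFamily (k + 1) g))) :
    1 - (16 * ((k + 1 : ℕ) * 2 ^ (k + 1) * μ) / (Fintype.card G * w) +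
        8 * ((k + 1 : ℕ) * 8 ^ (k + 1) * L ^ 2 / r) + 2 * q) ≤
      bernoulliExp p Finset.univ (fun S : Finset G => open Classical in
        if ((k + 1 : ℕ) : ℕ∞) < (SimpleGraph.mulCayley (S : Set G)).ediam then 1 else 0) := by
  classical
  set N : ℝ := (Fintype.card G : ℝ) with hN
  have hr0 : 0 < r := by linarith
  have hN0 : 0 < N := by rw [← hrN]; positivity
  set D := fun g : G => bernoulliExp p Finset.univ (degenerateInd (k + 1) g) with hD
  have hD0 : ∀ g, 0 ≤ D g := fun g => bernoulliExp_nonneg hp0 hp1 fun S _ =>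
    degenerateInd_nonneg _ _ _
  set T := Finset.univ.filter fun g => D g ≤ q with hT
  have hTcard : N / 2 ≤ T.card := by
    have h1 := sum_bernoulliExp_degenerateInd_le hp0 hp1 hr hrN hL hQ
    have h2 : ((Finset.univ.filter fun g => ¬ D g ≤ q).card : ℝ) * q ≤ ∑ g, D g := by
      rw [← nsmul_eq_mul]
      refine (Finset.card_nsmul_le_sum _ D q fun g hg => ?_).trans
        (Finset.sum_le_sum_of_subset_of_nonneg (Finset.subset_univ _) fun g _ _ => hD0 g)
      exact (not_le.1 (Finset.mem_filter.1 hg).2).le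
    have h3 : (T.card : ℝ) + (Finset.univ.filter fun g => ¬ D g ≤ q).card = N := by
      rw [hN, hT]
      exact_mod_cast Finset.card_filter_add_card_filter_not (s := (Finset.univ : Finset G)) _
    -- Markov's inequality: at most half of the group has degeneracy probability above `q`.
    have h4 : ((Finset.univ.filter fun g => ¬ D g ≤ q).card : ℝ) * q ≤ N / 2 * q := by
      refine (h2.trans h1).trans ((mul_le_mul_of_nonneg_left hqd hN0.le).trans_eq ?_)
      ring
    have h5 := le_of_mul_le_mul_right h4 hq
    linarith
  set u := fun (g : G) (S : Finset G) => avoidInd (signedFamily (k + 1) g) S with hu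
  set m := bernoulliExp p Finset.univ (fun S => ∑ g ∈ T, u g S) with hm
  have hmsum : m = ∑ g ∈ T, bernoulliExp p Finset.univ (u g) := by rw [hm, bernoulliExp_sum]
  have hmw : N * w / 2 ≤ m := by
    rw [hmsum]
    refine le_trans ?_ (Finset.card_nsmul_le_sum T _ w fun g _ => hwg g)
    rw [nsmul_eq_mul]
    nlinarith
  have hm0 : 0 < m := lt_of_lt_of_le (by positivity) hmw
  have hvar := variance_sum_avoidInd_signedFamily_le hp0 hp1 hr hrN hL hQ hμ T
  change bernoulliExp p Finset.univ (fun S => (∑ g ∈ T, u g S) ^ 2) - m ^ 2 ≤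
    (k + 1 : ℕ) * 2 ^ (k + 1) * μ * m + (k + 1 : ℕ) * 8 ^ (k + 1) * L ^ 2 / r *
      bernoulliExp p Finset.univ (fun S => (∑ g ∈ T, u g S) ^ 2) at hvar
  set c := (k + 1 : ℕ) * 2 ^ (k + 1) * μ with hc
  set δ := (k + 1 : ℕ) * 8 ^ (k + 1) * L ^ 2 / r with hδdef
  set X2 := bernoulliExp p Finset.univ (fun S => (∑ g ∈ T, u g S) ^ 2) with hX2
  have hc0 : 0 ≤ c := by positivity
  have hδ0 : 0 ≤ δ := by positivity
  have hXm : 0 ≤ X2 - m ^ 2 := sub_nonneg.2 (sq_bernoulliExp_le hp0 hp1 _ _)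
  -- Write `X2 = (X2 - m ^ 2) + m ^ 2` on the right of `hvar` and absorb the variance using `δ ≤ 1 /
  -- 2`.
  have hV : X2 - m ^ 2 ≤ 2 * c * m + 2 * δ * m ^ 2 := by nlinarith
  have hcen : bernoulliExp p Finset.univ (fun S => (∑ g ∈ T, u g S - m) ^ 2) = X2 - m ^ 2 := by
    have : ∀ S, (∑ g ∈ T, u g S - m) ^ 2 =
        (∑ g ∈ T, u g S) ^ 2 + ((-2 * m) * (∑ g ∈ T, u g S) + m ^ 2) := fun S => by ring
    simp only [this]
    rw [bernoulliExp_add, bernoulliExp_add, bernoulliExp_const_mul, bernoulliExp_const, ← hm]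
    ring
  have hdeg : bernoulliExp p Finset.univ
      (fun S => ∑ g ∈ T, u g S * degenerateInd (k + 1) g S) ≤ q * m := by
    rw [bernoulliExp_sum, hmsum, Finset.mul_sum]
    refine Finset.sum_le_sum fun g hg => ?_
    refine (bernoulliExp_mul_le_of_antitone_monotone hp0 hp1 _ (avoidInd_antitone _)
      (degenerateInd_monotone _ _)).trans ?_
    rw [mul_comm]
    exact mul_le_mul_of_nonneg_right (Finset.mem_filter.1 hg).2
      (bernoulliExp_nonneg hp0 hp1 fun S _ => avoidInd_nonneg _ _)
  have hmain := bernoulliExp_mono hp0 hp1 (V := Finset.univ)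
    fun S _ => one_le_ediam_indicator_add (d := k + 1) T hm0 S
  rw [bernoulliExp_const, bernoulliExp_add, bernoulliExp_add, bernoulliExp_const_mul,
    bernoulliExp_const_mul] at hmain
  have e1 : 4 / m ^ 2 * bernoulliExp p Finset.univ (fun S => (∑ g ∈ T, u g S - m) ^ 2) ≤
      16 * c / (N * w) + 8 * δ := by
    rw [hcen]
    calc 4 / m ^ 2 * (X2 - m ^ 2) ≤ 4 / m ^ 2 * (2 * c * m + 2 * δ * m ^ 2) :=
          mul_le_mul_of_nonneg_left hV (by positivity)
      _ = 8 * c / m + 8 * δ := by field_simp; ring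
      _ ≤ 8 * c / (N * w / 2) + 8 * δ := by gcongr
      _ = _ := by field_simp; ring
  have e2 : 2 / m * bernoulliExp p Finset.univ
      (fun S => ∑ g ∈ T, u g S * degenerateInd (k + 1) g S) ≤ 2 * q := by
    refine (mul_le_mul_of_nonneg_left hdeg (by positivity)).trans_eq ?_
    field_simp
  linarith

end Diameter

/-! ### From `setBernoulli` to finite sums. -/

section Bridge

theorem setBernoulli_real_eq_bernoulliExp {ι : Type*} [Fintype ι] [DecidableEq ι]
    (p : unitInterval) (P : Set ι → Prop) [DecidablePred P] :
    (setBernoulli (Set.univ : Set ι) p).real {S | P S} =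
      bernoulliExp (p : ℝ) Finset.univ (fun S : Finset ι => if P S then 1 else 0) := by
  classical
  have hset : {S : Set ι | P S} =
      ⋃ S ∈ (Finset.univ : Finset (Finset ι)).filter (fun S : Finset ι => P (S : Set ι)),
        {(S : Set ι)} := by
    ext S
    simp only [Set.mem_ofPred_eq, Finset.mem_filter, Finset.mem_univ, true_and, Set.mem_iUnion,
      Set.mem_singleton_iff, exists_prop]
    constructor
    · intro h
      exact ⟨S.toFinset, by simpa using h, by simp⟩
    · rintro ⟨S', h, rfl⟩; exact h
  rw [hset, measureReal_biUnion_finset]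
  · rw [bernoulliExp, Finset.powerset_univ, Finset.sum_filter]
    refine Finset.sum_congr rfl fun S _ => ?_
    by_cases h : P (S : Set ι)
    · rw [if_pos h, if_pos h, setBernoulli_real_singleton p (Set.subset_univ _) Set.finite_univ,
        Set.ncard_coe_finset, ← Finset.coe_univ, ← Finset.coe_sdiff, Set.ncard_coe_finset, mul_one]
    · rw [if_neg h, if_neg h, mul_zero]
  · intro S _ S' _ hne
    simpa [Function.onFun] using hne
  · intro S _
    exact .of_discrete

end Bridge

/-! ### Growth estimates in the admissible range of `d`. -/

section Asymptotics

/-- With `y = log log N`, the critical factor `d^(2d)` is at most `exp (d y)` because `d² ≤ exp y`,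
whereas `exp y / d ≥ 2 y D`. This leaves about `y D` for the remaining factors. -/
theorem mul_growth_le_exp_div {K y D d : ℝ} {n : ℕ} (hn : (n : ℝ) = d) (hd0 : 0 < d)
    (hdD : d ≤ D) (hD : D ^ 2 * (2 * y) = Real.exp y) (hD8 : 8 ≤ D) (hy8 : 8 ≤ y) (hyK : K ≤ y) :
    K * (d * 8 ^ n * (d ^ n * Real.exp y) ^ 2) ≤ Real.exp (Real.exp y / d) := by
  have hK : K ≤ Real.exp K := by linarith [Real.add_one_le_exp K]
  have hd : d ≤ Real.exp d := by linarith [Real.add_one_le_exp d]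
  have h8 : (8 : ℝ) ^ n ≤ Real.exp (3 * d) := by
    have h2 : (2 : ℝ) ≤ Real.exp 1 := by linarith [Real.add_one_le_exp (1 : ℝ)]
    have h83 : (8 : ℝ) ≤ Real.exp 3 := by
      have : Real.exp 3 = Real.exp 1 ^ 3 := by rw [← Real.exp_nat_mul]; norm_num
      rw [this]
      calc (8 : ℝ) = 2 ^ 3 := by norm_num
        _ ≤ _ := pow_le_pow_left₀ (by norm_num) h2 3
    calc (8 : ℝ) ^ n ≤ Real.exp 3 ^ n := pow_le_pow_left₀ (by norm_num) h83 n
      _ = Real.exp (3 * d) := by rw [← Real.exp_nat_mul, hn, mul_comm]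
  have hdy : d ≤ Real.exp (y / 2) := by
    refine le_of_sq_le_sq ?_ (Real.exp_pos _).le
    rw [← Real.exp_nat_mul]
    have : ((2 : ℕ) : ℝ) * (y / 2) = y := by push_cast; ring
    rw [this, ← hD]
    nlinarith [pow_le_pow_left₀ hd0.le hdD 2, sq_nonneg D]
  have hdn : d ^ n ≤ Real.exp (d * (y / 2)) := by
    calc d ^ n ≤ Real.exp (y / 2) ^ n := pow_le_pow_left₀ hd0.le hdy n
      _ = _ := by rw [← Real.exp_nat_mul, hn]
  have h1 : (d ^ n * Real.exp y) ^ 2 ≤ (Real.exp (d * (y / 2)) * Real.exp y) ^ 2 := by gcongr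
  calc K * (d * 8 ^ n * (d ^ n * Real.exp y) ^ 2)
      ≤ Real.exp K * (Real.exp d * Real.exp (3 * d) *
          (Real.exp (d * (y / 2)) * Real.exp y) ^ 2) := by gcongr
    _ = Real.exp (K + (d + 3 * d + (2 : ℕ) * (d * (y / 2) + y))) := by
        rw [Real.exp_add, Real.exp_add, Real.exp_add, Real.exp_nat_mul, Real.exp_add]
    _ ≤ _ := by
        refine Real.exp_le_exp.2 ?_
        have h2 : 2 * y * D ≤ Real.exp y / d := by
          rw [le_div_iff₀ hd0, ← hD]
          have : D * d ≤ D * D := by gcongr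
          nlinarith
        refine le_trans ?_ h2
        push_cast
        nlinarith [mul_le_mul_of_nonneg_right hdD (by linarith : 0 ≤ y + 4),
          mul_le_mul hD8 hy8 (by norm_num) (by linarith)]

theorem mul_growth_le_exp_mul {K y D d ε : ℝ} {n : ℕ} (hn : (n : ℝ) = d) (hd0 : 0 < d)
    (hdD : d ≤ D) (hD : D ^ 2 * (2 * y) = Real.exp y) (hD8 : 8 ≤ D) (hy8 : 8 ≤ y) (hyK : K ≤ y)
    (hyε : 8 ≤ ε * y) (hDε : 8 ≤ ε * D ^ 2) :
    K * (d * 2 ^ n * Real.exp y) ≤ Real.exp (ε / 2 * Real.exp y) := by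
  have hK : K ≤ Real.exp K := by linarith [Real.add_one_le_exp K]
  have hd : d ≤ Real.exp d := by linarith [Real.add_one_le_exp d]
  have h2n : (2 : ℝ) ^ n ≤ Real.exp d := by
    have h2 : (2 : ℝ) ≤ Real.exp 1 := by linarith [Real.add_one_le_exp (1 : ℝ)]
    calc (2 : ℝ) ^ n ≤ Real.exp 1 ^ n := pow_le_pow_left₀ (by norm_num) h2 n
      _ = Real.exp d := by rw [← Real.exp_nat_mul, hn, mul_one]
  calc K * (d * 2 ^ n * Real.exp y)
      ≤ Real.exp K * (Real.exp d * Real.exp d * Real.exp y) := by gcongr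
    _ = Real.exp (K + (d + d + y)) := by
        rw [Real.exp_add, Real.exp_add, Real.exp_add]
    _ ≤ _ := by
        refine Real.exp_le_exp.2 ?_
        rw [← hD]
        nlinarith [mul_le_mul_of_nonneg_right hDε (by linarith : 0 ≤ y),
          mul_le_mul_of_nonneg_right hyε (sq_nonneg D)]

theorem eventually_growth (γ : ℝ) (hγ0 : 0 < γ) (hγ1 : γ < 1) {ε : ℝ} (hε : 0 < ε) (K : ℝ) :
    ∀ᶠ N : ℕ in Filter.atTop, 1 ≤ Real.log N ∧ ∀ d : ℕ, 2 ≤ d → (d : ℝ) ≤ diamBound γ N →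
      K * (d * 8 ^ d * ((d : ℝ) ^ d * Real.log N) ^ 2) ≤ (N : ℝ) ^ (1 / (d : ℝ)) ∧
      K * (d * 2 ^ d * Real.log N) ≤ (N : ℝ) ^ (ε / 2) := by
  have hlog : Filter.Tendsto (fun N : ℕ => Real.log (N : ℝ)) Filter.atTop Filter.atTop :=
    Real.tendsto_log_atTop.comp tendsto_natCast_atTop_atTop
  have hloglog : Filter.Tendsto (fun N : ℕ => Real.log (Real.log (N : ℝ))) Filter.atTop
      Filter.atTop := Real.tendsto_log_atTop.comp hlog
  have hexp : Filter.Tendsto (fun y : ℝ => Real.exp y / y ^ 1) Filter.atTop Filter.atTop :=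
    Real.tendsto_exp_div_pow_atTop 1
  -- As `D ^ 2 = exp y / (2 y)`, the constants `128` and `16 / ε` give `D ^ 2 ≥ 64` and `D ^ 2 ≥ 8 /
  -- ε`.
  have hy : ∀ᶠ y : ℝ in Filter.atTop, 8 ≤ y ∧ K ≤ y ∧ 8 / ε ≤ y ∧ 128 ≤ Real.exp y / y ^ 1 ∧
      16 / ε ≤ Real.exp y / y ^ 1 :=
    (Filter.eventually_ge_atTop 8).and ((Filter.eventually_ge_atTop K).and
      ((Filter.eventually_ge_atTop _).and ((hexp.eventually_ge_atTop _).and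
        (hexp.eventually_ge_atTop _))))
  filter_upwards [hloglog.eventually hy, hlog.eventually_ge_atTop 1,
    Filter.eventually_ge_atTop 1] with N ⟨hy8, hyK, hyε, hy128, hy16⟩ hN1 hN
  refine ⟨hN1, fun d hd2 hd => ?_⟩
  set y := Real.log (Real.log (N : ℝ)) with hydef
  have hey : Real.exp y = Real.log N := Real.exp_log (by linarith)
  have hNpos : (0 : ℝ) < N := by exact_mod_cast hN
  rw [pow_one, le_div_iff₀ (by linarith)] at hy128 hy16
  set D := √(Real.log N / (2 * y)) with hDdef
  have hDsq : D ^ 2 = Real.log N / (2 * y) := Real.sq_sqrt (by positivity)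
  have hD : D ^ 2 * (2 * y) = Real.exp y := by rw [hDsq, hey]; field_simp
  have hD0 : 0 ≤ D := Real.sqrt_nonneg _
  have hdD : (d : ℝ) ≤ D := by
    refine hd.trans ?_
    change (1 - γ) * D ≤ D
    nlinarith
  have hD64 : 64 ≤ D ^ 2 := by nlinarith
  have hD8 : 8 ≤ D := by nlinarith
  have hDε : 8 ≤ ε * D ^ 2 := by
    have h1 : 8 / ε ≤ D ^ 2 := by
      have : 16 / ε = 2 * (8 / ε) := by ring
      rw [this] at hy16
      by_contra! hlt
      nlinarith [mul_lt_mul_of_pos_right hlt (by linarith : 0 < 2 * y)]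
    rw [div_le_iff₀ hε] at h1; linarith
  have hyε' : 8 ≤ ε * y := by rw [div_le_iff₀ hε] at hyε; linarith
  have hd0 : (0 : ℝ) < d := by exact_mod_cast (by omega : 0 < d)
  rw [Real.rpow_def_of_pos hNpos, Real.rpow_def_of_pos hNpos, ← hey]
  constructor
  · rw [mul_one_div]
    exact mul_growth_le_exp_div rfl hd0 hdD hD hD8 hy8 hyK
  · rw [mul_comm (Real.exp y) (ε / 2)]
    exact mul_growth_le_exp_mul rfl hd0 hdD hD hD8 hy8 hyK hyε' hDε

theorem exp_neg_le_one_sub {ε x : ℝ} (hε1 : ε ≤ 1) (hx0 : 0 ≤ x) (hx : x ≤ ε / 4) :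
    Real.exp (-((1 + ε / 2) * x)) ≤ 1 - x := by
  have h1 : 0 < 1 - x := by linarith
  rw [← Real.le_log_iff_exp_le h1]
  refine le_trans ?_ (Real.one_sub_inv_le_log_of_pos h1)
  rw [← sub_nonneg]
  have : 1 - (1 - x)⁻¹ - -((1 + ε / 2) * x) = x * ((1 + ε / 2) * (1 - x) - 1) / (1 - x) := by
    field_simp; ring
  rw [this]
  refine div_nonneg (mul_nonneg hx0 ?_) h1.le
  nlinarith

/-- Replacing `1 - x` by an exponential costs a factor `1 + ε / 2` in the exponent, and `(1 + ε / 2)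
(1 - ε) ≤ 1 - ε / 2` still leaves room. -/
theorem exp_neg_le_bernoulliExp_avoidInd {ι : Type*} [DecidableEq ι] {ε ℓ p : ℝ} {d : ℕ}
    {V : Finset ι} {𝒜 : Finset (Finset ι)} (hp0 : 0 ≤ p) (hp1 : p ≤ 1) (hε0 : 0 ≤ ε) (hε1 : ε ≤ 1)
    (hℓ : 0 ≤ ℓ) (h𝒜 : ∀ A ∈ 𝒜, A ⊆ V) (hd : ∀ A ∈ 𝒜, A.card = d) (hpε : p ^ d ≤ ε / 4)
    (hμ : 𝒜.card * p ^ d ≤ (1 - ε) * ℓ) :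
    Real.exp (-((1 - ε / 2) * ℓ)) ≤ bernoulliExp p V (avoidInd 𝒜) := by
  refine le_trans ?_ (prod_le_bernoulliExp_avoidInd hp0 hp1 𝒜 h𝒜)
  rw [Finset.prod_eq_pow_card (b := 1 - p ^ d) fun A hA => by rw [hd A hA]]
  refine le_trans ?_ (pow_le_pow_left₀ (Real.exp_pos _).le
    (exp_neg_le_one_sub hε1 (pow_nonneg hp0 d) hpε) _)
  rw [← Real.exp_nat_mul]
  refine Real.exp_le_exp.2 ?_
  have h2 := mul_le_mul_of_nonneg_left hμ (by linarith : 0 ≤ 1 + ε / 2)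
  have h3 : (1 + ε / 2) * ((1 - ε) * ℓ) ≤ (1 - ε / 2) * ℓ := by
    nlinarith [mul_nonneg hℓ (sq_nonneg ε)]
  linarith

theorem pow_le_of_le_abelianThreshold {ε p : ℝ} {d N : ℕ} (hε1 : ε ≤ 1) (hd : d ≠ 0) (hp0 : 0 ≤ p)
    (hp : p ≤ abelianThreshold ε d N) :
    p ^ d ≤ ((d.factorial : ℝ) * (1 - ε) / 2 ^ d) * (Real.log N / (N : ℝ) ^ (d - 1)) := by
  have hlog : 0 ≤ Real.log N := Real.log_natCast_nonneg N
  have h1 : 0 ≤ 1 - ε := by linarith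
  refine (pow_le_pow_left₀ hp0 hp d).trans_eq ?_
  rw [abelianThreshold, one_div]
  exact Real.rpow_inv_natCast_pow (by positivity) hd

end Asymptotics

/-! ### Choice of constants and conclusion. -/

/-- With high probability: for each `η > 0` the error probability is at most `η` as soon as the
order `N` is large, uniformly over the abelian groups `G` of order `N`, and over the admissible
`d` and `p`, which may vary with `G`. The diameter is `∞` for a disconnected graph. -/
theorem theorem3 (γ : ℝ) (hγ0 : 0 < γ) (hγ1 : γ < 1) (ε : ℝ) (hε0 : 0 < ε) (hε1 : ε ≤ 1)
    (η : ℝ) (hη : 0 < η) :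
    ∃ N₀ : ℕ, ∀ N : ℕ, N₀ ≤ N →
      ∀ (G : Type*) [CommGroup G] [Finite G], Nat.card G = N →
      ∀ d : ℕ, 2 ≤ d → (d : ℝ) ≤ diamBound γ N →
      ∀ p : unitInterval, (p : ℝ) ≤ abelianThreshold ε d N →
        1 - η ≤ (randomCayley G p).real {Γ : SimpleGraph G | (d : ℕ∞) < Γ.ediam} := by
  -- The total error will be `(16 + 8 + 4) / K ≤ η`; the other summands give `p ^ d ≤ ε / 4` and `δ
  -- ≤ 1 / 2`.
  set K : ℝ := 28 / η + 4 / ε + 2 with hK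
  obtain ⟨N₀, hN₀⟩ := Filter.eventually_atTop.1 (eventually_growth γ hγ0 hγ1 hε0 K)
  refine ⟨max N₀ 1, fun N hN G _ _ hcard d hd2 hd p hp => ?_⟩
  classical
  have := Fintype.ofFinite G
  rw [Nat.card_eq_fintype_card] at hcard
  obtain ⟨hlog1, hgrowth⟩ := hN₀ N ((le_max_left _ _).trans hN)
  obtain ⟨hA, hB⟩ := hgrowth d hd2 hd
  rw [randomCayley_real_apply]
  simp only [Set.mem_ofPred_eq]
  rw [setBernoulli_real_eq_bernoulliExp p
    (fun S => (d : ℕ∞) < (SimpleGraph.mulCayley S).ediam)]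
  obtain ⟨k, rfl⟩ : ∃ k, d = k + 1 := ⟨d - 1, by omega⟩
  have hp0 : (0 : ℝ) ≤ p := p.2.1
  have hp1 : (p : ℝ) ≤ 1 := p.2.2
  have hpd := pow_le_of_le_abelianThreshold hε1 (by omega : k + 1 ≠ 0) hp0 hp
  rw [Nat.add_sub_cancel] at hpd
  have hK0 : 0 < K := by positivity
  have hN1 : (1 : ℝ) ≤ N := by exact_mod_cast (le_max_right _ _).trans hN
  have hN0 : (0 : ℝ) < N := by linarith
  set d : ℕ := k + 1 with hdk
  set r : ℝ := (N : ℝ) ^ (1 / (d : ℝ)) with hr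
  set ℓ : ℝ := Real.log N with hℓ
  -- Deliberately crude: `d ^ d` covers the factorial and also the `(2 d + 1) ^ d` of the degenerate
  -- count, so one growth bound serves both. The sharp constant is needed only in `hμ`.
  set L : ℝ := (d : ℝ) ^ d * ℓ with hLdef
  have hd1 : (1 : ℝ) ≤ d := by exact_mod_cast (by omega : 1 ≤ d)
  have hdd1 : 1 ≤ (d : ℝ) ^ d := one_le_pow₀ hd1
  have hL1 : 1 ≤ L := by rw [hLdef]; nlinarith
  have hr1 : 1 ≤ r := Real.one_le_rpow hN1 (by positivity)
  have hr0 : 0 < r := by linarith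
  have hrN : r ^ d = N := by
    rw [hr, one_div]; exact Real.rpow_inv_natCast_pow hN0.le (by omega)
  -- This needs `k ≥ 1`, that is `d ≥ 2`; it serves to bound `p ^ d`.
  have hrle : r ≤ N ^ k := by
    calc r = r ^ 1 := (pow_one r).symm
      _ ≤ (r ^ d) ^ k := by rw [← pow_mul]; exact pow_le_pow_right₀ hr1 (by nlinarith)
      _ = _ := by rw [hrN]
  have hfac : (d.factorial : ℝ) * (1 - ε) / 2 ^ d ≤ (d : ℝ) ^ d := by
    have h1 : (d.factorial : ℝ) ≤ (d : ℝ) ^ d := by exact_mod_cast Nat.factorial_le_pow d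
    rw [div_le_iff₀ (by positivity)]
    have h2 : (1 : ℝ) ≤ 2 ^ d := one_le_pow₀ (by norm_num)
    calc (d.factorial : ℝ) * (1 - ε) ≤ (d : ℝ) ^ d * 1 := by gcongr; linarith
      _ ≤ _ := by gcongr
  have hpL : (p : ℝ) ^ d ≤ L / N ^ k := by
    refine hpd.trans ((mul_le_mul_of_nonneg_right hfac (by positivity)).trans_eq ?_)
    rw [hLdef]; ring
  have hQ : ((N : ℝ) * p) ^ d ≤ N * L := by
    rw [mul_pow]
    calc (N : ℝ) ^ d * (p : ℝ) ^ d ≤ N ^ d * (L / N ^ k) := by gcongr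
      _ = N * L := by rw [hdk, pow_succ]; field_simp
  have hμ : ∀ g : G, ((signedFamily d g).card : ℝ) * (p : ℝ) ^ d ≤ (1 - ε) * ℓ := by
    intro g
    have h1 : (d.factorial : ℝ) * (signedFamily d g).card ≤ 2 ^ d * (N : ℝ) ^ k := by
      have := factorial_mul_card_signedFamily_le k g
      rw [hcard] at this
      exact_mod_cast this
    have hε' : 0 ≤ 1 - ε := by linarith
    calc ((signedFamily d g).card : ℝ) * (p : ℝ) ^ d
        ≤ (signedFamily d g).card *
          ((d.factorial : ℝ) * (1 - ε) / 2 ^ d * (ℓ / (N : ℝ) ^ k)) := by gcongr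
      _ = (d.factorial * (signedFamily d g).card) * ((1 - ε) * ℓ / (2 ^ d * N ^ k)) := by
          field_simp
      _ ≤ (2 ^ d * (N : ℝ) ^ k) * ((1 - ε) * ℓ / (2 ^ d * N ^ k)) := by gcongr
      _ = _ := by field_simp
  have hE : (d : ℝ) * 8 ^ d * L ^ 2 / r ≤ 1 / K := by
    rw [div_le_div_iff₀ hr0 hK0]; linarith
  have hLd : (d : ℝ) ^ d ≤ L := by rw [hLdef]; nlinarith
  have hLr : L / r ≤ 1 / K := by
    refine le_trans ?_ hE
    have h8 : (1 : ℝ) ≤ 8 ^ d := one_le_pow₀ (by norm_num)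
    gcongr
    calc L = 1 * 1 * (L * 1) := by ring
      _ ≤ d * 8 ^ d * (L * L) := by gcongr
      _ = _ := by ring
  have hdegen : (d : ℝ) * (2 * (d : ℝ) + 1) ^ d * L / r ≤ 1 / K := by
    refine le_trans ?_ hE
    gcongr ?_ / r
    calc (d : ℝ) * (2 * (d : ℝ) + 1) ^ d * L ≤ d * (8 * d) ^ d * L := by gcongr; linarith
      _ = d * 8 ^ d * ((d : ℝ) ^ d * L) := by rw [mul_pow]; ring
      _ ≤ d * 8 ^ d * (L * L) := by gcongr
      _ = _ := by ring
  have hKη : 28 / K ≤ η := by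
    rw [div_le_iff₀ hK0, hK]
    have : η * (28 / η + 4 / ε + 2) = 28 + η * (4 / ε + 2) := by
      field_simp; ring
    rw [this]; linarith [show 0 ≤ η * (4 / ε + 2) by positivity]
  have hKε : 1 / K ≤ ε / 4 := by
    rw [div_le_iff₀ hK0, hK]
    have : ε / 4 * (28 / η + 4 / ε + 2) = 1 + ε / 4 * (28 / η + 2) := by field_simp; ring
    rw [this]; linarith [show 0 ≤ ε / 4 * (28 / η + 2) by positivity]
  have hK2 : 1 / K ≤ 1 / 2 := by
    refine one_div_le_one_div_of_le (by norm_num) ?_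
    rw [hK]; linarith [show 0 ≤ 28 / η + 4 / ε by positivity]
  have hpε : (p : ℝ) ^ d ≤ ε / 4 := by
    refine hpL.trans (le_trans ?_ (hLr.trans hKε))
    gcongr
  set w : ℝ := Real.exp (-((1 - ε / 2) * ℓ)) with hw
  have hwg : ∀ g : G, w ≤ bernoulliExp p Finset.univ (avoidInd (signedFamily d g)) := by
    intro g
    exact exp_neg_le_bernoulliExp_avoidInd hp0 hp1 hε0.le hε1 (by linarith)
      (fun A _ => Finset.subset_univ A) (fun A hA => (mem_signedFamily.1 hA).1) hpε (hμ g)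
  have hNw : (N : ℝ) * w = (N : ℝ) ^ (ε / 2) := by
    rw [Real.rpow_def_of_pos hN0, hw]
    nth_rewrite 1 [← Real.exp_log hN0]
    rw [← Real.exp_add]
    congr 1
    rw [← hℓ]; ring
  have hc : 16 * ((d : ℝ) * 2 ^ d * ((1 - ε) * ℓ)) / (N * w) ≤ 16 / K := by
    rw [hNw, div_le_div_iff₀ (by positivity) hK0]
    have h1 : (d : ℝ) * 2 ^ d * ((1 - ε) * ℓ) ≤ d * 2 ^ d * ℓ := by
      gcongr
      exact mul_le_of_le_one_left (by linarith only [hlog1]) (by linarith only [hε0])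
    linarith only [mul_le_mul_of_nonneg_left h1 hK0.le, hB]
  have hmain := bernoulliExp_lt_ediam_ge (G := G) (k := k) (p := p) (r := r) (L := L)
    (μ := (1 - ε) * ℓ) (q := 2 / K) (w := w) hp0 hp1 hr1 (by rw [hcard]; exact hrN) hL1
    (by rw [hcard]; exact hQ) (mul_nonneg (by linarith) (by linarith)) hμ (by positivity)
    (by refine hdegen.trans_eq ?_; ring) (hE.trans hK2) (Real.exp_pos _) hwg
  rw [hcard] at hmain
  refine le_trans ?_ hmain
  have hsum : 16 / K + 8 * (1 / K) + 2 * (2 / K) = 28 / K := by ring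
  linarith
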